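/- A group is torsion-free if its only element of finite order is the identity, and virtually abelian if it has an abelian subgroup of finite index. All classes of groups are understood to be closed under isomorphism. The class of elementary amenable groups is the smallest class of groups which contains all finite and all abelian groups and is closed under extensions and directed unions. The direct sum of a family of groups $(G_i)_{i\in I}$ is the subgroup of $\prod_{i\in I}G_i$ of families with only finitely many nontrivial entries. Let $\mathcal C$ (Linnell's class) be the smallest class of groups which contains all free groups and is closed under directed unions and under extensions with virtually abelian quotient. Let $\mathcal C'$ be the class of all groups $G$ which have a normal subgroup $N$ isomorphic to a direct sum of free groups such that $G/N$ is elementary amenable. Let $\mathcal D$ be the smallest non-empty class of groups such that: 1. if $G$ is torsion-free, $A$ is elementary amenable, and $p\colon G\to A$ is a surjective homomorphism such that $p^{-1}(E)\in\mathcal D$ for every finite subgroup $E$ of $A$, then $G\in\mathcal D$; 2. every subgroup of a group in $\mathcal D$ is in $\mathcal D$; 3. the direct limit of every direct system, and the inverse limit of every inverse system, of groups in $\mathcal D$ indexed by a (non-empty) directed set is in $\mathcal D$ (the structure maps are arbitrary homomorphisms). Then every torsion-free group in $\mathcal C$ and every torsion-free group in $\mathcal C'$ belongs to $\mathcal D$.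 Moreover, for every family $(G_i)_{i\in I}$ of groups in $\mathcal D$ (with $I$ an arbitrary set), the direct sum, the direct product $\prod_{i\in I}G_i$ and the free product $\ast_{i\in I}G_i$ of the family belong to $\mathcal D$. -/

import Mathlib

universe u

/-- A group is torsion-free if its only element of finite order is the identity. -/
def GroupIsTorsionFree (G : Type u) [Group G] : Prop :=
  ∀ g : G, IsOfFinOrder g → g = 1

/-- A group is virtually abelian if it has an abelian subgroup of finite index. -/
def GroupIsVirtuallyAbelian (G : Type u) [Group G] : Prop :=
  ∃ H : Subgroup G, H.FiniteIndex ∧ ∀ a ∈ H, ∀ b ∈ H, a * b = b * a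

/-- The class of elementary amenable groups: the smallest class of groups that contains all finite
and all abelian groups and is closed under extensions and directed unions. -/
inductive IsElementaryAmenable : (G : Type u) → [Group G] → Prop
  | ofFinite {G : Type u} [Group G] (h : Finite G) : IsElementaryAmenable G
  | ofAbelian {G : Type u} [Group G] (h : ∀ a b : G, a * b = b * a) : IsElementaryAmenable G
  | extension {N G A : Type u} [Group N] [Group G] [Group A] (S : GroupExtension N G A)
      (hN : IsElementaryAmenable N) (hA : IsElementaryAmenable A) : IsElementaryAmenable G
  | directedUnion {G : Type u} [Group G] {ι : Type u} [Nonempty ι] (H : ι → Subgroup G)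
      (hdir : Directed (· ≤ ·) H) (hunion : ∀ g : G, ∃ i, g ∈ H i)
      (hH : ∀ i, IsElementaryAmenable (H i)) : IsElementaryAmenable G

/-- Linnell's class `𝒞`: the smallest class of groups that contains all free groups and is closed
under directed unions and under extensions with virtually abelian quotient. -/
inductive LinnellC : (G : Type u) → [Group G] → Prop
  | free {G : Type u} [Group G] (h : IsFreeGroup G) : LinnellC G
  | directedUnion {G : Type u} [Group G] {ι : Type u} [Nonempty ι] (H : ι → Subgroup G)
      (hdir : Directed (· ≤ ·) H) (hunion : ∀ g : G, ∃ i, g ∈ H i)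
      (hH : ∀ i, LinnellC (H i)) : LinnellC G
  | extension {N G A : Type u} [Group N] [Group G] [Group A] (S : GroupExtension N G A)
      (hN : LinnellC N) (hA : GroupIsVirtuallyAbelian A) : LinnellC G

/-- The direct sum (restricted direct product) of a family of groups: the subgroup of the direct
product formed by the families with only finitely many nontrivial entries. -/
def groupDirectSum {ι : Type u} (G : ι → Type u) [∀ i, Group (G i)] : Subgroup (∀ i, G i) where
  carrier := {x | {i | x i ≠ 1}.Finite}
  one_mem' := by simp
  mul_mem' := by
    intro x y hx hy
    refine (Set.Finite.union hx hy).subset ?_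
    intro i hi
    by_contra h
    simp only [Set.mem_union, Set.mem_ofPred_eq, not_or, not_not] at h
    exact hi (by simp [h.1, h.2])
  inv_mem' := by
    intro x hx
    simpa using hx

/-- The class `𝒞'`: extensions of direct sums of free groups with elementary amenable quotient. -/
def LinnellCPrime (G : Type u) [Group G] : Prop :=
  ∃ (ι : Type u) (F : ι → Type u) (_ : ∀ i, Group (F i)) (A : Type u) (_ : Group A),
    (∀ i, IsFreeGroup (F i)) ∧ IsElementaryAmenable A ∧
      Nonempty (GroupExtension (groupDirectSum F) G A)

/-- The inverse limit of an inverse system of groups, as the subgroup of compatible families in the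
direct product. -/
def groupInverseLimit {ι : Type u} [Preorder ι] (G : ι → Type u) [∀ i, Group (G i)]
    (f : ∀ ⦃i j : ι⦄, i ≤ j → G j →* G i) : Subgroup (∀ i, G i) where
  carrier := {x | ∀ ⦃i j : ι⦄ (h : i ≤ j), f h (x j) = x i}
  one_mem' := by
    intro i j h
    simp
  mul_mem' := by
    intro x y hx hy i j h
    simp [hx h, hy h]
  inv_mem' := by
    intro x hx i j h
    simp [hx h]

/-- The class `𝒟`: the smallest nonempty class of groups that is
* closed under the following kind of extension: `G` belongs to it if `G` is torsion-free and there
  is a surjection `p : G → A` onto an elementary amenable group such that `p⁻¹(E)` belongs to the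
  class for every finite subgroup `E` of `A`;
* closed under subgroups (and isomorphisms);
* closed under direct limits and inverse limits of systems of groups over directed index sets (the
  structure maps need be neither injective nor surjective).

As a class closed under subgroups and isomorphisms is nonempty if and only if it contains the
trivial group, nonemptiness is expressed by the constructor `trivialGroup`. -/
inductive SchickD : (G : Type u) → [Group G] → Prop
  | trivialGroup : SchickD PUnit.{u + 1}
  | extension {G A : Type u} [Group G] [Group A] (hG : GroupIsTorsionFree G)
      (hA : IsElementaryAmenable A) (p : G →* A) (hp : Function.Surjective p)
      (h : ∀ E : Subgroup A, Finite E → SchickD (E.comap p)) : SchickD G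
  | subgroup {H G : Type u} [Group H] [Group G] (f : H →* G) (hf : Function.Injective f)
      (hG : SchickD G) : SchickD H
  | directLimit {ι : Type u} [Preorder ι] [IsDirectedOrder ι] [Nonempty ι] (G : ι → Type u)
      [∀ i, Group (G i)] (f : ∀ i j : ι, i ≤ j → G i →* G j)
      [DirectedSystem G (fun i j h => f i j h)] (hG : ∀ i, SchickD (G i)) :
      SchickD (DirectLimit G f)
  | inverseLimit {ι : Type u} [Preorder ι] [IsDirectedOrder ι] [Nonempty ι] (G : ι → Type u)
      [∀ i, Group (G i)] (f : ∀ ⦃i j : ι⦄, i ≤ j → G j →* G i)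
      [InverseSystem (fun _ _ h => f h)] (hG : ∀ i, SchickD (G i)) :
      SchickD (groupInverseLimit G f)

/-!
The class `𝒟` is `SchickD`. A basic criterion for membership is a homomorphism onto a torsion-free
elementary amenable group with kernel in `𝒟` (`SchickD.of_ker`).

*Free groups.* Transvections over `ℤ[X]` that are congruent to `1` modulo `X` play ping-pong, so a
free group embeds into a congruence subgroup. Its congruence filtration has torsion-free nilpotent
quotients, and the free group lies in their inverse limit (`SchickD.freeGroup`).

*Products.* The product with a fixed group of `𝒟` and the free product with a fixed free group are
compatible with every construction that generates `𝒟`, hence preserve `𝒟` (`SchickD.prod`,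
`SchickD.coprod_freeGroup`).
A direct product embeds into the inverse limit of its finite subproducts, and the free product of the
groups `G i` embeds into the free product of `∏ G i` with a free group, by conjugating the factors by
distinct free generators (`SchickD.coprodI`).

*Torsion.* The key to the classes `𝒞` and `𝒞'` is that, for a free normal subgroup `F` of a torsion-free
group `W`, the quotient `W / ⁅F, F⁆` is again torsion-free
(`GroupIsTorsionFree.quotient_commutator`). This reduces to the case where `F` has prime index `p` and
`u ^ p ∈ ⁅F, F⁆` for some `u ∉ F`. Over the field with `p` elements, tensor induction of the group
algebra of `F` gives a representation of `W` with two bases: the first is permuted freely, the second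
is permuted freely up to one vector that spans a complement to the kernel of the augmentation
(`exists_permutation_bases`). Comparing invariant functionals in these bases yields a homomorphism
from `F` to the field taking the value `1` on `u ^ p`, a contradiction.

*The class `𝒞`.* By induction, every torsion-free group `U` with a subgroup of finite index embedding
into a group of `𝒞` lies in `𝒟` (`LinnellC.schickD_of_finiteIndex`). If `K` is a suitable normal
subgroup of finite index in `U`, then `U / ⁅K, K⁆` is abelian-by-finite. In the free case this quotient
is torsion-free; in the case of an extension `⁅K, K⁆` embeds into the kernel of the extension.

*The class `𝒞'`.* Let `N` be the direct sum of free groups and `M = ⁅N, N⁆`, which is the direct sum of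
the noncommutative free groups `⁅F i, F i⁆`. Since commuting elements of free groups are so
restricted, conjugations permute the summands of `M`
(`DirectSumDecomposition.exists_forall_apply_eq_one_iff`). If `u ^ p ∈ ⁅M, M⁆` with `u ∉ M`, the
coordinates of `u ^ p` can be made trivial one at a time by multiplying `u` by elements of `M`: for a
summand moved by `u` directly, for a fixed one by the torsion result for free normal subgroups. This
ends with torsion in the group itself. So the quotient by `⁅M, M⁆` is torsion-free; it is elementary
amenable, and `⁅M, M⁆` is contained in a direct sum of free groups.
-/


/-! ### First closure properties of the class `𝒟` -/

theorem SchickD.isTorsionFree {G : Type u} [Group G] (h : SchickD G) : GroupIsTorsionFree G := by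
  induction h with
  | trivialGroup => exact fun _ _ => rfl
  | extension hG => exact hG
  | subgroup f hf _ ih =>
    intro g hg
    exact hf ((ih _ (f.isOfFinOrder hg)).trans (map_one f).symm)
  | @directLimit ι _ _ _ G _ f _ _ ih =>
    intro g hg
    obtain ⟨n, hn, hgn⟩ := isOfFinOrder_iff_pow_eq_one.1 hg
    obtain ⟨i, x, rfl⟩ := DirectLimit.exists_eq_mk _ g
    rw [DirectLimit.npow_def, DirectLimit.one_def i] at hgn
    obtain ⟨j, hij, _, hj⟩ := Quotient.exact hgn
    have h1 : f i j hij x = 1 := by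
      refine ih j _ (isOfFinOrder_iff_pow_eq_one.2 ⟨n, hn, ?_⟩)
      simpa using hj
    rw [DirectLimit.one_def i]
    exact Quotient.sound ⟨j, hij, hij, by simpa using h1⟩
  | inverseLimit _ _ _ ih =>
    intro g hg
    obtain ⟨n, hn, hgn⟩ := isOfFinOrder_iff_pow_eq_one.1 hg
    refine Subtype.ext (funext fun i => ih i _ (isOfFinOrder_iff_pow_eq_one.2 ⟨n, hn, ?_⟩))
    simpa using congrFun (congrArg Subtype.val hgn) i

theorem SchickD.of_subsingleton (G : Type u) [Group G] [Subsingleton G] : SchickD G :=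
  .subgroup (1 : G →* PUnit) (fun _ _ _ => Subsingleton.elim _ _) .trivialGroup

theorem GroupIsTorsionFree.of_injective {H G : Type*} [Group H] [Group G]
    (hG : GroupIsTorsionFree G) (f : H →* G) (hf : Function.Injective f) :
    GroupIsTorsionFree H := fun _ hg =>
  hf ((hG _ (f.isOfFinOrder hg)).trans (map_one f).symm)

theorem GroupIsTorsionFree.eq_one_of_pow_eq_one {G : Type*} [Group G]
    (hG : GroupIsTorsionFree G) {g : G} {n : ℕ} (hn : n ≠ 0) (h : g ^ n = 1) : g = 1 :=
  hG g (isOfFinOrder_iff_pow_eq_one.2 ⟨n, Nat.pos_of_ne_zero hn, h⟩)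

theorem GroupIsTorsionFree.eq_bot_of_finite {G : Type*} [Group G]
    (hG : GroupIsTorsionFree G) (E : Subgroup G) [Finite E] : E = ⊥ := by
  rw [Subgroup.eq_bot_iff_forall]
  intro x hx
  exact hG x (E.subtype.isOfFinOrder (isOfFinOrder_of_finite (⟨x, hx⟩ : E)))

/-- Over a torsion-free quotient the only finite subgroup is trivial, so only the kernel has to
be examined. -/
theorem SchickD.of_ker {G A : Type u} [Group G] [Group A] (hA : IsElementaryAmenable A)
    (hAt : GroupIsTorsionFree A) (p : G →* A) (hp : Function.Surjective p)
    (h : SchickD p.ker) : SchickD G := by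
  refine .extension ?_ hA p hp fun E _ => ?_
  · intro g hg
    have h1 : p g = 1 := hAt _ (p.isOfFinOrder hg)
    have h2 : (⟨g, h1⟩ : p.ker) = 1 :=
      h.isTorsionFree _ (Submonoid.isOfFinOrder_coe.1 hg)
    exact congrArg Subtype.val h2
  · obtain rfl := hAt.eq_bot_of_finite E
    exact h

theorem IsElementaryAmenable.schickD {G : Type u} [Group G] (hG : IsElementaryAmenable G)
    (ht : GroupIsTorsionFree G) : SchickD G := by
  refine .of_ker hG ht (MonoidHom.id G) Function.surjective_id ?_
  have : Subsingleton (MonoidHom.id G).ker :=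
    ⟨fun a b => Subtype.ext (a.2.trans b.2.symm)⟩
  exact .of_subsingleton _

/-- A group embedding into the inverse limit of a system of groups in `𝒟` belongs to `𝒟`. -/
theorem SchickD.of_inverseSystem {ι : Type u} [Preorder ι] [IsDirectedOrder ι] [Nonempty ι]
    (K : ι → Type u) [∀ i, Group (K i)] (f : ∀ ⦃i j : ι⦄, i ≤ j → K j →* K i)
    [InverseSystem (fun _ _ h => f h)] (hK : ∀ i, SchickD (K i)) {G : Type u} [Group G]
    (φ : ∀ i, G →* K i) (hφ : ∀ ⦃i j : ι⦄ (h : i ≤ j) (g : G), f h (φ j g) = φ i g)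
    (hinj : ∀ g : G, (∀ i, φ i g = 1) → g = 1) : SchickD G := by
  refine .subgroup (G := groupInverseLimit K f)
    ((MonoidHom.pi φ).codRestrict _ fun g i j h => hφ h g) ?_ (.inverseLimit K f hK)
  rw [injective_iff_map_eq_one]
  intro g hg
  exact hinj g fun i => congrFun (congrArg Subtype.val hg) i

section DirectLimit

variable {ι : Type*} [Preorder ι] [IsDirectedOrder ι] [Nonempty ι] {K : ι → Type*}
  [∀ i, Group (K i)] (f : ∀ i j : ι, i ≤ j → K i →* K j)
  [DirectedSystem K (fun i j h => f i j h)]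

/-- The canonical homomorphism from a term of a directed system to the direct limit. -/
noncomputable def directLimitMk (i : ι) : K i →* DirectLimit K f :=
  MonoidHom.mk' (fun x => ⟦⟨i, x⟩⟧) fun x y => (DirectLimit.mul_def i x y).symm

theorem directLimitMk_map {i j : ι} (h : i ≤ j) (x : K i) :
    directLimitMk f j (f i j h x) = directLimitMk f i x := DirectLimit.mk_apply i j x h

theorem exists_directLimitMk_eq (z : DirectLimit K f) : ∃ i x, directLimitMk f i x = z := by
  obtain ⟨i, x, rfl⟩ := DirectLimit.exists_eq_mk f z
  exact ⟨i, x, rfl⟩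

/-- The homomorphism out of a direct limit of groups given by a compatible family. -/
noncomputable def directLimitLift {G : Type*} [Group G] (φ : ∀ i, K i →* G)
    (hφ : ∀ i j (h : i ≤ j) (x : K i), φ j (f i j h x) = φ i x) : DirectLimit K f →* G :=
  MonoidHom.mk' (DirectLimit.lift f (fun i x => φ i x) fun i j h x => (hφ i j h x).symm)
    fun a b => by
      induction a, b using DirectLimit.induction₂ with
      | ih i x y => simp [DirectLimit.mul_def]

end DirectLimit

/-- A group which has the two properties that characterize the direct limit of a system of groups in
`𝒟` belongs to `𝒟`. -/
theorem SchickD.of_directedSystem {ι : Type u} [Preorder ι] [IsDirectedOrder ι] [Nonempty ι]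
    (K : ι → Type u) [∀ i, Group (K i)] (f : ∀ i j : ι, i ≤ j → K i →* K j)
    [DirectedSystem K (fun i j h => f i j h)] (hK : ∀ i, SchickD (K i)) {G : Type u} [Group G]
    (φ : ∀ i, K i →* G) (hφ : ∀ i j (h : i ≤ j) (x : K i), φ j (f i j h x) = φ i x)
    (hsurj : ∀ g : G, ∃ i x, φ i x = g)
    (hker : ∀ i (x : K i), φ i x = 1 → ∃ j, ∃ h : i ≤ j, f i j h x = 1) : SchickD G := by
  let Φ : DirectLimit K f →* G := directLimitLift f φ hφ
  have hΦ : Function.Bijective Φ := by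
    constructor
    · rw [injective_iff_map_eq_one]
      intro a ha
      induction a using DirectLimit.induction with
      | ih i x =>
        obtain ⟨j, hij, hj⟩ := hker i x ha
        rw [DirectLimit.one_def i]
        exact Quotient.sound ⟨j, hij, hij, by simpa using hj⟩
    · intro g
      obtain ⟨i, x, hx⟩ := hsurj g
      exact ⟨⟦⟨i, x⟩⟧, hx⟩
  exact .subgroup (MulEquiv.ofBijective Φ hΦ).symm.toMonoidHom
    (MulEquiv.ofBijective Φ hΦ).symm.injective (.directLimit K f hK)

/-- A group belongs to `𝒟` if it is residually in `𝒟` with respect to a descending sequence of normal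
subgroups. -/
theorem SchickD.of_antitone_normal {G : Type u} [Group G] (N : ℕ → Subgroup G)
    [hn : ∀ n, (N n).Normal] (hN : Antitone N) (h1 : ∀ g, (∀ n, g ∈ N n) → g = 1)
    (h : ∀ n, SchickD (G ⧸ N n)) : SchickD G := by
  let f : ∀ ⦃i j : ULift.{u} ℕ⦄, i ≤ j → (G ⧸ N j.down) →* (G ⧸ N i.down) := fun i j hij =>
    QuotientGroup.map _ _ (MonoidHom.id G) (hN (show i.down ≤ j.down from hij))
  have : InverseSystem (fun _ _ h => f h) :=
    ⟨fun i x => by induction x using QuotientGroup.induction_on with | H z => rfl,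
      fun i j k _ _ x => by induction x using QuotientGroup.induction_on with | H z => rfl⟩
  refine .of_inverseSystem (fun n : ULift.{u} ℕ => G ⧸ N n.down) f (fun n => h n.down)
    (fun n => QuotientGroup.mk' (N n.down)) (fun i j hij g => rfl) fun g hg => h1 g fun n => ?_
  exact (QuotientGroup.eq_one_iff g).1 (hg ⟨n⟩)

theorem SchickD.of_fg_subgroups {G : Type u} [Group G]
    (h : ∀ V : Subgroup G, V.FG → SchickD V) : SchickD G := by
  let ι := {V : Subgroup G // V.FG}
  have : Nonempty ι := ⟨⟨⊥, ∅, by simp⟩⟩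
  have : IsDirectedOrder ι :=
    ⟨fun a b => ⟨⟨a.1 ⊔ b.1, a.2.sup b.2⟩, le_sup_left (a := a.1), le_sup_right (a := a.1)⟩⟩
  let f : ∀ i j : ι, i ≤ j → i.1 →* j.1 := fun i j hij => Subgroup.inclusion hij
  have : DirectedSystem (fun i : ι => i.1) (fun i j h => f i j h) :=
    ⟨fun _ _ => rfl, fun _ _ _ _ _ _ => rfl⟩
  refine .of_directedSystem (fun i : ι => i.1) f (fun i => h i.1 i.2) (fun i => i.1.subtype)
    (fun _ _ _ _ => rfl) (fun g => ?_) (fun i x hx => ⟨i, le_rfl, Subtype.ext hx⟩)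
  exact ⟨⟨Subgroup.closure {g}, ⟨{g}, by simp⟩⟩, ⟨g, Subgroup.subset_closure rfl⟩, rfl⟩

/-! ### Free groups -/

section Congruence

variable {G : Type u} [Group G] {A : Type*} [Ring A] {t : A}

theorem pow_dvd_mul_of_pow_dvd (ht : ∀ a, Commute t a) {m n : ℕ} {a b : A} (ha : t ^ m ∣ a)
    (hb : t ^ n ∣ b) : t ^ (m + n) ∣ a * b := by
  obtain ⟨x, rfl⟩ := ha
  obtain ⟨y, rfl⟩ := hb
  refine ⟨x * y, ?_⟩
  rw [pow_add, mul_assoc, mul_assoc, ← mul_assoc x, ← ((ht x).pow_left n).eq, mul_assoc]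

theorem pow_dvd_mul_left_of_pow_dvd (ht : ∀ a, Commute t a) {n : ℕ} {b : A} (a : A)
    (hb : t ^ n ∣ b) : t ^ n ∣ a * b := by
  simpa using pow_dvd_mul_of_pow_dvd (m := 0) ht (by simp) hb

/-- The `n`-th congruence subgroup of a group acting by units of a ring with central element `t`:
the elements that act trivially modulo `t ^ (n + 1)`. -/
def congruenceSubgroup (ht : ∀ a, Commute t a) (ρ : G →* A) (n : ℕ) : Subgroup G where
  carrier := {g | t ^ (n + 1) ∣ ρ g - 1}
  one_mem' := by simp
  mul_mem' := by
    intro a b ha hb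
    have : ρ (a * b) - 1 = (ρ a - 1) * ρ b + (ρ b - 1) := by rw [map_mul]; noncomm_ring
    rw [Set.mem_ofPred_eq, this]
    exact dvd_add (dvd_mul_of_dvd_left ha _) hb
  inv_mem' := by
    intro a ha
    have : ρ a⁻¹ - 1 = -(ρ a⁻¹ * (ρ a - 1)) := by
      rw [mul_sub, ← map_mul, inv_mul_cancel, map_one, mul_one, neg_sub]
    rw [Set.mem_ofPred_eq, this]
    exact dvd_neg.2 (pow_dvd_mul_left_of_pow_dvd ht _ ha)

variable (ht : ∀ a, Commute t a) (ρ : G →* A)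

theorem mem_congruenceSubgroup {n : ℕ} {g : G} :
    g ∈ congruenceSubgroup ht ρ n ↔ t ^ (n + 1) ∣ ρ g - 1 := Iff.rfl

instance congruenceSubgroup_normal (n : ℕ) : (congruenceSubgroup ht ρ n).Normal where
  conj_mem := by
    intro a ha g
    have : ρ (g * a * g⁻¹) - 1 = ρ g * (ρ a - 1) * ρ g⁻¹ := by
      rw [mul_sub, sub_mul, mul_one, ← map_mul, ← map_mul, ← map_mul, mul_inv_cancel, map_one]
    rw [mem_congruenceSubgroup, this]
    exact dvd_mul_of_dvd_left (pow_dvd_mul_left_of_pow_dvd ht _ ha) _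

theorem congruenceSubgroup_antitone : Antitone (congruenceSubgroup ht ρ) := fun _ _ h _ hg =>
  (pow_dvd_pow t (Nat.succ_le_succ h)).trans hg

/-- Successive congruence subgroups have abelian quotients, because
`(a - 1) (b - 1) - (b - 1) (a - 1)` is divisible by `t ^ (2 (n + 1))`. -/
theorem commutator_mem_congruenceSubgroup {n : ℕ} {a b : G} (ha : a ∈ congruenceSubgroup ht ρ n)
    (hb : b ∈ congruenceSubgroup ht ρ n) :
    a * b * (b * a)⁻¹ ∈ congruenceSubgroup ht ρ (n + 1) := by
  have h : ρ (a * b * (b * a)⁻¹) - 1 =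
      ((ρ a - 1) * (ρ b - 1) - (ρ b - 1) * (ρ a - 1)) * ρ (b * a)⁻¹ := by
    have h1 : (ρ a - 1) * (ρ b - 1) - (ρ b - 1) * (ρ a - 1) = ρ (a * b) - ρ (b * a) := by
      rw [map_mul, map_mul]; noncomm_ring
    rw [h1, sub_mul, ← map_mul, ← map_mul, mul_inv_cancel, map_one]
  rw [mem_congruenceSubgroup, h]
  refine dvd_mul_of_dvd_left (dvd_sub ?_ ?_) _
  · exact (pow_dvd_pow t (by omega)).trans (pow_dvd_mul_of_pow_dvd ht ha hb)
  · exact (pow_dvd_pow t (by omega)).trans (pow_dvd_mul_of_pow_dvd ht hb ha)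

/-- An element of a group acting trivially modulo `t` lies in a congruence subgroup as soon as a
proper power does, provided that `A / t A` is torsion-free. -/
theorem mem_congruenceSubgroup_of_pow_mem (ht0 : ∀ a : A, t * a = 0 → a = 0)
    (htf : ∀ (m : ℕ) (a : A), m ≠ 0 → t ∣ m • a → t ∣ a) (h : ∀ g, t ∣ ρ g - 1)
    {m : ℕ} (hm : m ≠ 0) {g : G} {n : ℕ} (hg : g ^ m ∈ congruenceSubgroup ht ρ n) :
    g ∈ congruenceSubgroup ht ρ n := by
  induction n with
  | zero => simpa [mem_congruenceSubgroup] using h g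
  | succ n ih =>
    have hgn := ih (congruenceSubgroup_antitone ht ρ n.le_succ hg)
    -- modulo `t ^ (2 (n + 1))` the map `g ↦ ρ g - 1` turns powers into multiples
    have key : ∀ m : ℕ, t ^ (n + 1 + (n + 1)) ∣ ρ g ^ m - 1 - m • (ρ g - 1) := by
      intro m
      induction m with
      | zero => simp
      | succ m ihm =>
        have : ρ g ^ (m + 1) - 1 - (m + 1) • (ρ g - 1) =
            (ρ g ^ m - 1 - m • (ρ g - 1)) * ρ g + m • ((ρ g - 1) * (ρ g - 1)) := by
          rw [pow_succ, add_smul, one_smul, mul_sub (ρ g - 1), smul_sub m (_ * _), sub_mul _ _ (ρ g),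
            sub_mul _ _ (ρ g), smul_mul_assoc, mul_one, one_mul]
          abel
        rw [this]
        refine dvd_add (dvd_mul_of_dvd_left ihm _) ?_
        rw [nsmul_eq_mul]
        exact pow_dvd_mul_left_of_pow_dvd ht _ (pow_dvd_mul_of_pow_dvd ht hgn hgn)
    obtain ⟨x, hx⟩ := hgn
    have h2 : t ^ (n + 1 + 1) ∣ m • (ρ g - 1) := by
      have h3 := dvd_sub (show t ^ (n + 1 + 1) ∣ ρ g ^ m - 1 from map_pow ρ g m ▸ hg)
        ((pow_dvd_pow t (by omega : n + 1 + 1 ≤ n + 1 + (n + 1))).trans (key m))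
      simpa using h3
    have hcancel : ∀ (k : ℕ) (a : A), t ^ k * a = 0 → a = 0 := by
      intro k
      induction k with
      | zero => intro a ha; simpa using ha
      | succ k ihk =>
        intro a ha
        rw [pow_succ, mul_assoc] at ha
        exact ht0 _ (ihk _ ha)
    obtain ⟨y, hy⟩ := h2
    have h4 : m • x = t * y := by
      rw [← sub_eq_zero]
      apply hcancel (n + 1)
      rw [mul_sub, mul_smul_comm, ← hx, hy, pow_succ t (n + 1), mul_assoc, sub_self]
    obtain ⟨z, hz⟩ := htf m x hm ⟨y, h4⟩
    exact ⟨z, by rw [hx, hz, pow_succ t (n + 1), mul_assoc]⟩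

/-- A group embedding into the units of a ring `A` that are congruent to `1` modulo a central
nonzerodivisor `t` lies in `𝒟` if `A` is `t`-adically separated and `A / t A` is torsion-free: it
is residually torsion-free nilpotent. -/
theorem SchickD.of_congruence (ht : ∀ a, Commute t a) (ρ : G →* A)
    (ht0 : ∀ a : A, t * a = 0 → a = 0)
    (htf : ∀ (m : ℕ) (a : A), m ≠ 0 → t ∣ m • a → t ∣ a)
    (hsep : ∀ a : A, (∀ n, t ^ (n + 1) ∣ a) → a = 0) (hρ : Function.Injective ρ)
    (h : ∀ g, t ∣ ρ g - 1) : SchickD G := by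
  refine .of_antitone_normal (congruenceSubgroup ht ρ) (congruenceSubgroup_antitone ht ρ)
    (fun g hg => ?_) fun n => ?_
  · refine hρ ?_
    rw [map_one, ← sub_eq_zero]
    exact hsep _ hg
  · refine IsElementaryAmenable.schickD ?_ ?_
    · induction n with
      | zero =>
        refine .ofAbelian fun a b => ?_
        obtain ⟨a, rfl⟩ := QuotientGroup.mk_surjective a
        obtain ⟨b, rfl⟩ := QuotientGroup.mk_surjective b
        refine QuotientGroup.eq.2 ?_
        rw [mem_congruenceSubgroup, zero_add, pow_one]
        exact h _
      | succ n ih =>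
        let q : (G ⧸ congruenceSubgroup ht ρ (n + 1)) →* (G ⧸ congruenceSubgroup ht ρ n) :=
          QuotientGroup.map _ _ (MonoidHom.id G) (congruenceSubgroup_antitone ht ρ n.le_succ)
        have hq : Function.Surjective q := fun x => by
          obtain ⟨a, rfl⟩ := QuotientGroup.mk_surjective x
          exact ⟨a, rfl⟩
        refine .extension ⟨q.ker.subtype, q, q.ker.subtype_injective, by simp, hq⟩
          (.ofAbelian ?_) ih
        rintro ⟨a, ha⟩ ⟨b, hb⟩
        obtain ⟨a, rfl⟩ := QuotientGroup.mk_surjective a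
        obtain ⟨b, rfl⟩ := QuotientGroup.mk_surjective b
        have ha' : a ∈ congruenceSubgroup ht ρ n := (QuotientGroup.eq_one_iff a).1 ha
        have hb' : b ∈ congruenceSubgroup ht ρ n := (QuotientGroup.eq_one_iff b).1 hb
        refine Subtype.ext ?_
        have := (QuotientGroup.eq_one_iff _).2 (commutator_mem_congruenceSubgroup ht ρ ha' hb')
        exact mul_inv_eq_one.1 this
    · intro x hx
      obtain ⟨m, hm, hxm⟩ := isOfFinOrder_iff_pow_eq_one.1 hx
      obtain ⟨g, rfl⟩ := QuotientGroup.mk_surjective x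
      exact (QuotientGroup.eq_one_iff g).2 (mem_congruenceSubgroup_of_pow_mem ht ρ ht0 htf h hm.ne'
        ((QuotientGroup.eq_one_iff (g ^ m)).1 hxm))

end Congruence

section FreeGroup

open Polynomial Module

variable {S : Type u}

/-- The linear form `w ↦ ∑ r ≠ s, w r`. -/
noncomputable def sumOff (s : S) : (S →₀ ℤ[X]) →ₗ[ℤ[X]] ℤ[X] :=
  Finsupp.linearCombination ℤ[X] (fun _ => (1 : ℤ[X])) - Finsupp.lapply s

theorem sumOff_single (s : S) (a : ℤ[X]) : sumOff s (Finsupp.single s a) = 0 := by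
  simp [sumOff]

theorem sumOff_eq_add [DecidableEq S] {r s : S} (h : r ≠ s) (w : S →₀ ℤ[X]) :
    sumOff s w = w r + ∑ q ∈ (w.support.erase s).erase r, w q := by
  have h1 : sumOff s w = ∑ q ∈ w.support.erase s, w q := by
    by_cases hs : s ∈ w.support
    · rw [sumOff, LinearMap.sub_apply, Finsupp.linearCombination_apply, Finsupp.sum,
        ← Finset.add_sum_erase _ _ hs]
      simp
    · rw [Finset.erase_eq_of_notMem hs, sumOff, LinearMap.sub_apply,
        Finsupp.linearCombination_apply, Finsupp.sum, Finsupp.lapply_apply,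
        Finsupp.notMem_support_iff.1 hs]
      simp
  rw [h1]
  by_cases hr : r ∈ w.support.erase s
  · exact (Finset.add_sum_erase _ _ hr).symm
  · have : w r = 0 := by simpa [h] using hr
    rw [this, zero_add, Finset.erase_eq_of_notMem hr]

/-- The one-parameter group of transvections `w ↦ w + m X (∑ r ≠ s, w r) e_s`. -/
noncomputable def transvectionHom (s : S) :
    Multiplicative ℤ →* (Module.End ℤ[X] (S →₀ ℤ[X]))ˣ :=
  MonoidHom.toHomUnits
    { toFun := fun m => 1 + (m.toAdd • X : ℤ[X]) • (sumOff s).smulRight (Finsupp.single s 1)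
      map_one' := by simp
      map_mul' := by
        intro m n
        have hN : (sumOff s).smulRight (Finsupp.single s (1 : ℤ[X])) *
            (sumOff s).smulRight (Finsupp.single s 1) = 0 := by
          ext1 r
          ext1
          simp only [Module.End.mul_eq_comp, LinearMap.comp_apply, LinearMap.smulRight_apply,
            map_smul, sumOff_single, smul_zero, zero_smul, LinearMap.zero_apply]
        rw [mul_add, add_mul, add_mul, smul_mul_smul_comm, hN, smul_zero, add_zero, one_mul,
          one_mul, mul_one, toAdd_mul, add_smul, add_smul, add_assoc] }

theorem transvectionHom_smul (s : S) (m : Multiplicative ℤ) (w : S →₀ ℤ[X]) :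
    transvectionHom s m • w = w + Finsupp.single s (m.toAdd • X * sumOff s w) := by
  simp [transvectionHom, Units.smul_def]

/-- The ping-pong set: vectors whose `s`-th coordinate has the strictly largest degree. -/
def dominatedBy (s : S) : Set (S →₀ ℤ[X]) := {w | ∀ r, r ≠ s → (w r).degree < (w s).degree}

theorem transvectionHom_smul_mem {r s : S} (h : r ≠ s) {m : Multiplicative ℤ} (hm : m ≠ 1)
    {w : S →₀ ℤ[X]} (hw : w ∈ dominatedBy r) : transvectionHom s m • w ∈ dominatedBy s := by
  classical
  have h0 : ⊥ < (w r).degree := (bot_le).trans_lt (hw s h.symm)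
  have hsum : (sumOff s w).degree = (w r).degree := by
    rw [sumOff_eq_add h, degree_add_eq_left_of_degree_lt]
    refine (degree_sum_le _ _).trans_lt ((Finset.sup_lt_iff h0).2 fun q hq => ?_)
    exact hw q (Finset.ne_of_mem_erase hq)
  have hX : (m.toAdd • X * sumOff s w : ℤ[X]).degree = 1 + (w r).degree := by
    have hm' : m.toAdd ≠ 0 := fun h => hm (by simpa using h)
    rw [degree_mul, hsum, smul_eq_C_mul, degree_C_mul hm', degree_X]
  have hlt : (w r).degree < 1 + (w r).degree := by
    rw [degree_eq_natDegree (fun h => by simp [h] at h0)]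
    exact_mod_cast Nat.lt_add_of_pos_left Nat.one_pos
  intro q hq
  rw [transvectionHom_smul, Finsupp.add_apply, Finsupp.add_apply, Finsupp.single_eq_of_ne hq,
    add_zero, Finsupp.single_eq_same]
  rw [degree_add_eq_right_of_degree_lt, hX]
  · by_cases hqr : q = r
    · exact hqr ▸ hlt
    · exact (hw q hqr).trans hlt
  · rw [hX]
    exact (hw s h.symm).trans hlt

/-- The transvections `transvectionHom s` generate a free group: they play ping-pong on the sets
`dominatedBy s`. -/
theorem injective_lift_transvection [Nontrivial S] : Function.Injective
    (FreeGroup.lift fun s : S => transvectionHom s (Multiplicative.ofAdd 1)) := by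
  classical
  have h1 : FreeGroup.lift (fun s : S => transvectionHom s (Multiplicative.ofAdd 1)) =
      (Monoid.CoprodI.lift fun s => FreeGroup.lift fun _ : Unit =>
        transvectionHom s (Multiplicative.ofAdd 1)).comp
        (@freeGroupEquivCoprodI S).toMonoidHom := by
    ext i
    simp
  rw [h1, MonoidHom.coe_comp]
  refine Function.Injective.comp ?_ (MulEquiv.injective freeGroupEquivCoprodI)
  obtain ⟨i⟩ := (inferInstance : Nonempty S)
  refine Monoid.CoprodI.lift_injective_of_ping_pong _
    (Or.inr ⟨i, ?_⟩) dominatedBy ?_ ?_ ?_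
  · have : Infinite (FreeGroup Unit) := inferInstance
    exact (Cardinal.ofNat_lt_aleph0.le.trans (Cardinal.infinite_iff.1 this))
  · intro s
    refine ⟨Finsupp.single s 1, fun r hr => ?_⟩
    rw [Finsupp.single_eq_of_ne hr, Finsupp.single_eq_same]
    simp
  · intro r s hrs
    refine Set.disjoint_left.2 fun w hr hs => ?_
    exact lt_asymm (hr s hrs.symm) (hs r hrs)
  · intro s r hsr h hh
    obtain ⟨m, rfl⟩ : ∃ m : ℤ, h = FreeGroup.of () ^ m :=
      ⟨_, (FreeGroup.freeGroupUnitEquivInt.left_inv h).symm⟩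
    rintro _ ⟨w, hw, rfl⟩
    have : FreeGroup.lift (fun _ : Unit => transvectionHom s (Multiplicative.ofAdd 1))
        (FreeGroup.of () ^ m) = transvectionHom s (Multiplicative.ofAdd m) := by
      rw [map_zpow, FreeGroup.lift_apply_of, ← map_zpow, ← ofAdd_zsmul, smul_eq_mul, mul_one]
    simp only [this]
    refine transvectionHom_smul_mem hsr.symm (fun hm => hh ?_) hw
    rw [ofAdd_eq_one] at hm
    rw [hm, zpow_zero]

/-- Divisibility by `X` in the endomorphism ring can be tested on matrix entries. -/
theorem X_dvd_end_iff (φ : Module.End ℤ[X] (S →₀ ℤ[X])) :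
    algebraMap ℤ[X] (Module.End ℤ[X] (S →₀ ℤ[X])) X ∣ φ ↔ ∀ v s, X ∣ φ v s := by
  constructor
  · rintro ⟨ψ, rfl⟩ v s
    exact ⟨ψ v s, by simp⟩
  · intro h
    refine ⟨Finsupp.lsum ℤ fun r => LinearMap.toSpanSingleton ℤ[X] _
      ((φ (Finsupp.single r 1)).mapRange divX divX_zero), ?_⟩
    ext1 r
    ext1
    ext1 s
    obtain ⟨p, hp⟩ := h (Finsupp.single r 1) s
    have hd : (X * p).divX = p := by ext n; simp [coeff_divX]
    simp [hp, hd]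

/-- The transvections are congruent to `1` modulo `X`, so `SchickD.of_congruence` applies to the
faithful representation that they define. -/
theorem SchickD.freeGroup_of_nontrivial [Nontrivial S] : SchickD (FreeGroup S) := by
  let ρ : FreeGroup S →* Module.End ℤ[X] (S →₀ ℤ[X]) := (Units.coeHom _).comp
    (FreeGroup.lift fun s : S => transvectionHom s (Multiplicative.ofAdd 1))
  have ht : ∀ a, Commute (algebraMap ℤ[X] (Module.End ℤ[X] (S →₀ ℤ[X])) X) a :=
    Algebra.commutes X
  have hinj : Function.Injective ρ := Units.val_injective.comp injective_lift_transvection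
  refine SchickD.of_congruence (A := Module.End ℤ[X] (S →₀ ℤ[X])) ht ρ ?_ ?_ ?_ hinj ?_
  · intro a ha
    ext1 r
    ext1
    ext1 s
    have := DFunLike.congr_fun (DFunLike.congr_fun ha (Finsupp.single r 1)) s
    simpa using this
  · intro m a hm h
    rw [X_dvd_end_iff] at h ⊢
    intro v s
    have := h v s
    rw [X_dvd_iff] at this ⊢
    simpa [hm] using this
  · intro a h
    ext1 r
    ext1
    ext1 s
    by_contra hne
    have hdvd : ∀ n, X ^ (n + 1) ∣ a (Finsupp.single r 1) s := by
      intro n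
      obtain ⟨b, rfl⟩ := h n
      refine ⟨b (Finsupp.single r 1) s, ?_⟩
      rw [← map_pow, Module.End.mul_apply, Module.algebraMap_end_apply, Finsupp.smul_apply,
        smul_eq_mul]
    have := natDegree_le_of_dvd (hdvd (a (Finsupp.single r 1) s).natDegree) (by simpa using hne)
    simp at this
  · have h0 : ∀ g, g ∈ congruenceSubgroup (A := Module.End ℤ[X] (S →₀ ℤ[X])) ht ρ 0 := by
      intro g
      induction g using FreeGroup.induction_on with
      | C1 => exact one_mem _
      | of s =>
        rw [mem_congruenceSubgroup, zero_add, pow_one]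
        refine ⟨(sumOff s).smulRight (Finsupp.single s 1), ?_⟩
        ext1 r
        ext1
        simp [ρ, transvectionHom]
      | inv_of s h => exact inv_mem h
      | mul a b ha hb => exact mul_mem ha hb
    intro g
    simpa only [mem_congruenceSubgroup, zero_add, pow_one] using h0 g

/-- Two generators are added to make the generating set nontrivial, as ping-pong needs. -/
theorem SchickD.freeGroup (S : Type u) : SchickD (FreeGroup S) := by
  refine .subgroup (FreeGroup.map (some ∘ some : S → Option (Option S)))
    (FreeGroup.map_injective ((Option.some_injective _).comp (Option.some_injective _)))
    .freeGroup_of_nontrivial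

end FreeGroup

theorem SchickD.of_isFreeGroup (G : Type u) [Group G] [IsFreeGroup G] : SchickD G :=
  .subgroup (IsFreeGroup.toFreeGroup G).toMonoidHom (IsFreeGroup.toFreeGroup G).injective
    (.freeGroup _)

/-! ### Direct limits, direct sums and direct products -/

/-- A retract of a direct limit of groups in `𝒟` lies in `𝒟`. -/
theorem SchickD.of_retract {ι : Type u} [Preorder ι] [IsDirectedOrder ι] [Nonempty ι]
    (K : ι → Type u) [∀ i, Group (K i)] (f : ∀ i j : ι, i ≤ j → K i →* K j)
    [DirectedSystem K (fun i j h => f i j h)] (hK : ∀ i, SchickD (K i)) {G : Type u} [Group G]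
    (r : DirectLimit K f →* G) (s : G →* DirectLimit K f) (h : r.comp s = MonoidHom.id G) :
    SchickD G :=
  .subgroup s (Function.LeftInverse.injective (g := r) (DFunLike.congr_fun h)) (.directLimit K f hK)

/-- The product with a fixed group of `𝒟` commutes with all constructions that generate `𝒟`, so the
claim follows by induction on the membership of the first factor. -/
theorem SchickD.prod {G H : Type u} [Group G] [Group H] (hG : SchickD G) (hH : SchickD H) :
    SchickD (G × H) := by
  induction hG with
  | trivialGroup =>
    refine .subgroup (MonoidHom.snd PUnit H) ?_ hH
    rintro ⟨a, b⟩ ⟨c, d⟩ h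
    exact Prod.ext rfl h
  | @extension G A _ _ hG hA p hp _ ih =>
    refine .extension ?_ hA (p.comp (MonoidHom.fst G H)) (hp.comp Prod.fst_surjective)
      fun E hE => ?_
    · intro x hx
      exact Prod.ext (hG _ ((MonoidHom.fst G H).isOfFinOrder hx))
        (hH.isTorsionFree _ ((MonoidHom.snd G H).isOfFinOrder hx))
    · refine .subgroup (G := E.comap p × H)
        (MonoidHom.prod (((MonoidHom.fst G H).comp (Subgroup.subtype _)).codRestrict _
          fun x => x.2) ((MonoidHom.snd G H).comp (Subgroup.subtype _))) ?_ (ih E hE)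
      intro x y h
      have h1 : x.1.1 = y.1.1 := congrArg (fun z => (z.1 : G)) h
      have h2 : x.1.2 = y.1.2 := (Prod.ext_iff.1 h).2
      exact Subtype.ext (Prod.ext h1 h2)
  | @subgroup G' G _ _ f hf _ ih =>
    exact .subgroup (f.prodMap (MonoidHom.id H)) (hf.prodMap Function.injective_id) ih
  | @directLimit ι _ _ _ K _ f _ _ ih =>
    have : DirectedSystem (fun i => K i × H)
        (fun i j h => (f i j h).prodMap (MonoidHom.id H)) :=
      ⟨fun i x => Prod.ext (DirectedSystem.map_self' f x.1) rfl,
        fun k j i hij hjk x => Prod.ext (DirectedSystem.map_map' f hij hjk x.1) rfl⟩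
    refine .of_directedSystem (fun i => K i × H) (fun i j h => (f i j h).prodMap (MonoidHom.id H))
      ih (fun i => (directLimitMk f i).prodMap (MonoidHom.id H))
      (fun i j h x => Prod.ext (directLimitMk_map f h x.1) rfl) (fun g => ?_) fun i x hx => ?_
    · obtain ⟨i, x, hx⟩ := exists_directLimitMk_eq f g.1
      exact ⟨i, (x, g.2), Prod.ext hx rfl⟩
    · have h1 : directLimitMk f i x.1 = directLimitMk f i 1 :=
        (congrArg Prod.fst hx).trans (map_one _).symm
      obtain ⟨j, hij, _, hj⟩ := Quotient.exact h1
      have h2 : x.2 = 1 := (Prod.ext_iff.1 hx).2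
      exact ⟨j, hij, Prod.ext (hj.trans (map_one _)) h2⟩
  | @inverseLimit ι _ _ _ K _ f _ _ ih =>
    have : InverseSystem (F := fun i => K i × H)
        (fun _ _ h => (f h).prodMap (MonoidHom.id H)) :=
      ⟨fun i x => Prod.ext (InverseSystem.map_self (f := fun _ _ h => f h) x.1) rfl,
        fun k j i hkj hji x =>
          Prod.ext (InverseSystem.map_map (f := fun _ _ h => f h) hkj hji x.1) rfl⟩
    refine .of_inverseSystem (fun i => K i × H) (fun _ _ h => (f h).prodMap (MonoidHom.id H)) ih
      (fun i => MonoidHom.prodMap ((Pi.evalMonoidHom K i).comp (Subgroup.subtype _))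
        (MonoidHom.id H)) (fun i j h g => Prod.ext (g.1.2 h) rfl) fun g hg => ?_
    obtain ⟨i⟩ := (inferInstance : Nonempty ι)
    have h1 : ∀ i, g.1.1 i = 1 := fun i => congrArg Prod.fst (hg i)
    have h2 : g.2 = 1 := congrArg Prod.snd (hg i)
    exact Prod.ext (Subtype.ext (funext h1)) h2

theorem SchickD.pi_finset {ι : Type u} (G : ι → Type u) [∀ i, Group (G i)]
    (h : ∀ i, SchickD (G i)) (s : Finset ι) : SchickD (∀ i : s, G i) := by
  classical
  induction s using Finset.induction_on with
  | empty => exact .of_subsingleton _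
  | insert a s ha ih =>
    refine .subgroup (G := G a × ∀ i : s, G i)
      (MonoidHom.prod (Pi.evalMonoidHom (fun i : ↥(insert a s) => G i)
        ⟨a, Finset.mem_insert_self a s⟩) (MonoidHom.pi fun i : s =>
          Pi.evalMonoidHom (fun i : ↥(insert a s) => G i)
            ⟨i, Finset.mem_insert_of_mem i.2⟩)) ?_ ((h a).prod ih)
    intro x y hxy
    ext ⟨i, hi⟩
    rcases Finset.mem_insert.1 hi with rfl | his
    · exact congrArg Prod.fst hxy
    · exact congrFun (congrArg Prod.snd hxy) ⟨i, his⟩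

/-- A direct product is contained in the inverse limit of its finite subproducts. -/
theorem SchickD.pi {ι : Type u} (G : ι → Type u) [∀ i, Group (G i)]
    (h : ∀ i, SchickD (G i)) : SchickD (∀ i, G i) := by
  classical
  let f : ∀ ⦃s t : Finset ι⦄, s ≤ t → (∀ i : t, G i) →* (∀ i : s, G i) := fun s t hst =>
    MonoidHom.pi fun i => Pi.evalMonoidHom (fun i : t => G i) ⟨i, hst i.2⟩
  have : InverseSystem (fun _ _ h => f h) := ⟨fun _ _ => rfl, fun _ _ _ _ _ _ => rfl⟩
  refine .of_inverseSystem (fun s : Finset ι => ∀ i : s, G i) f (SchickD.pi_finset G h)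
    (fun s => MonoidHom.pi fun i => Pi.evalMonoidHom G i) (fun _ _ _ _ => rfl) fun g hg => ?_
  funext i
  exact congrFun (hg {i}) ⟨i, Finset.mem_singleton_self i⟩

theorem SchickD.directSum {ι : Type u} (G : ι → Type u) [∀ i, Group (G i)]
    (h : ∀ i, SchickD (G i)) : SchickD (groupDirectSum G) :=
  .subgroup (groupDirectSum G).subtype (Subgroup.subtype_injective _) (.pi G h)

/-! ### Free products -/

open Monoid Coprod

section CocycleAction

variable {G T S W : Type*} [Group G] [MulAction G T] [Group W]

/-- The permutation action of `G` on `T × W` twisted by a cocycle `κ : G × T → W`. -/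
def cocyclePerm (κ : G → T → W) (hκ : ∀ g h x, κ (g * h) x = κ g (h • x) * κ h x) :
    G →* Equiv.Perm (T × W) :=
  have h1 : ∀ x, κ 1 x = 1 := fun x => by
    have := hκ 1 1 x
    rwa [one_smul, mul_one, left_eq_mul] at this
  MonoidHom.mk' (fun g =>
    { toFun := fun y => (g • y.1, κ g y.1 * y.2)
      invFun := fun y => (g⁻¹ • y.1, κ g⁻¹ y.1 * y.2)
      left_inv := fun y => by
        ext1
        · simp
        · simp [← mul_assoc, ← hκ, h1]
      right_inv := fun y => by
        ext1
        · simp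
        · simp only
          rw [← mul_assoc]
          have := hκ g g⁻¹ y.1
          rw [mul_inv_cancel, h1] at this
          rw [← this, one_mul] })
    fun g h => by
      ext1 y
      simp [mul_smul, hκ, mul_assoc]

/-- The permutation of `T × W` which multiplies the fibre over `x` by `c x`. -/
def fiberPerm (c : T → W) : Equiv.Perm (T × W) where
  toFun y := (y.1, c y.1 * y.2)
  invFun y := (y.1, (c y.1)⁻¹ * y.2)
  left_inv y := by simp
  right_inv y := by simp

/-- The action of `G ∗ F(S)` on `T × W` in which `G` acts through a cocycle and the free group acts
fibrewise. -/
def coprodPerm (κ : G → T → W) (hκ : ∀ g h x, κ (g * h) x = κ g (h • x) * κ h x)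
    (c : S → T → W) : G ∗ FreeGroup S →* Equiv.Perm (T × W) :=
  Coprod.lift (cocyclePerm κ hκ) (FreeGroup.lift fun s => fiberPerm (c s))

theorem coprodFree_induction {P : G ∗ FreeGroup S → Prop} (hG : ∀ g, P (inl g))
    (hS : ∀ s, P (inr (FreeGroup.of s))) (hmul : ∀ a b, P a → P b → P (a * b))
    (hinv : ∀ a, P a → P a⁻¹) (u : G ∗ FreeGroup S) : P u := by
  induction u using Coprod.induction_on with
  | inl g => exact hG g
  | inr w =>
    induction w using FreeGroup.induction_on with
    | C1 => simpa using hG 1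
    | of s => exact hS s
    | inv_of s h => simpa using hinv _ h
    | mul a b ha hb => simpa using hmul _ _ ha hb
  | mul a b ha hb => exact hmul _ _ ha hb

variable (κ : G → T → W) (hκ : ∀ g h x, κ (g * h) x = κ g (h • x) * κ h x) (c : S → T → W)

theorem coprodPerm_inl (g : G) (y : T × W) :
    coprodPerm κ hκ c (inl g) y = (g • y.1, κ g y.1 * y.2) := rfl

theorem coprodPerm_of (s : S) (y : T × W) :
    coprodPerm κ hκ c (inr (FreeGroup.of s)) y = (y.1, c s y.1 * y.2) := by
  simp [coprodPerm, fiberPerm]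

theorem coprodPerm_fst (u : G ∗ FreeGroup S) (y : T × W) :
    (coprodPerm κ hκ c u y).1 = fst u • y.1 := by
  induction u using coprodFree_induction generalizing y with
  | hG g => rfl
  | hS s => rw [coprodPerm_of]; simp
  | hmul a b ha hb => rw [map_mul, Equiv.Perm.mul_apply, ha, hb, map_mul, mul_smul]
  | hinv a ha =>
    rw [map_inv, map_inv, eq_inv_smul_iff, ← ha, ← Equiv.Perm.mul_apply, mul_inv_cancel,
      Equiv.Perm.one_apply]

theorem coprodPerm_mul_right (u : G ∗ FreeGroup S) (x : T) (w v : W) :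
    (coprodPerm κ hκ c u (x, w * v)).2 = (coprodPerm κ hκ c u (x, w)).2 * v := by
  suffices h : ∀ y : T × W, coprodPerm κ hκ c u (y.1, y.2 * v) =
      ((coprodPerm κ hκ c u y).1, (coprodPerm κ hκ c u y).2 * v) from
    congrArg Prod.snd (h (x, w))
  induction u using coprodFree_induction with
  | hG g => intro y; simp [coprodPerm_inl, mul_assoc]
  | hS s => intro y; simp [coprodPerm_of, mul_assoc]
  | hmul a b ha hb => intro y; simp [hb, ha]
  | hinv a ha =>
    intro y
    rw [map_inv, Equiv.Perm.inv_eq_iff_eq, ha]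
    simp

/-- A map that is equivariant for the generators of `G ∗ F(S)` is equivariant. -/
theorem coprodPerm_equivariant (Ψ : T × W → G ∗ FreeGroup S)
    (hG : ∀ g y, Ψ (g • y.1, κ g y.1 * y.2) = inl g * Ψ y)
    (hS : ∀ s y, Ψ (y.1, c s y.1 * y.2) = inr (FreeGroup.of s) * Ψ y) (u : G ∗ FreeGroup S)
    (y : T × W) : Ψ (coprodPerm κ hκ c u y) = u * Ψ y := by
  induction u using coprodFree_induction generalizing y with
  | hG g => exact hG g y
  | hS s => rw [coprodPerm_of]; exact hS s y
  | hmul a b ha hb => rw [map_mul, Equiv.Perm.mul_apply, ha, hb, mul_assoc]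
  | hinv a ha =>
    rw [eq_inv_mul_iff_mul_eq, ← ha, map_inv, ← Equiv.Perm.mul_apply, mul_inv_cancel,
      Equiv.Perm.one_apply]

end CocycleAction

/-- If the generators of a free group act on the image of `e : W → α` as left multiplications by
their images under a homomorphism `j` to `W`, then so do all elements. -/
theorem perm_apply_eq_of_freeGroup {L W α : Type*} [Group W] (θ : FreeGroup L →* Equiv.Perm α)
    (j : FreeGroup L →* W) (e : W → α)
    (h : ∀ l w, θ (FreeGroup.of l) (e w) = e (j (FreeGroup.of l) * w)) (y : FreeGroup L) (w : W) :
    θ y (e w) = e (j y * w) := by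
  induction y using FreeGroup.induction_on generalizing w with
  | C1 => simp
  | of l => exact h l w
  | inv_of l _ =>
    rw [map_inv, Equiv.Perm.inv_eq_iff_eq, h, ← mul_assoc, ← map_mul, mul_inv_cancel, map_one,
      one_mul]
  | mul a b ha hb => rw [map_mul, Equiv.Perm.mul_apply, hb, ha, map_mul, mul_assoc]

section Cosets

variable {G : Type u} [Group G] (K : Subgroup G)

/-- A representative of a left coset. -/
noncomputable def cosetRep (x : G ⧸ K) : G := x.out

@[simp]
theorem cosetRep_mk (x : G ⧸ K) : ((cosetRep K x : G) : G ⧸ K) = x := x.out_eq'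

/-- The cocycle of the action of `G` on the cosets of `K`, with values in `K`. -/
noncomputable def cosetCocycle (g : G) (x : G ⧸ K) : K :=
  ⟨(cosetRep K (g • x))⁻¹ * (g * cosetRep K x), by
    rw [← QuotientGroup.eq, cosetRep_mk K, ← smul_eq_mul, ← MulAction.Quotient.smul_coe,
      cosetRep_mk K]⟩

theorem cosetCocycle_mul (g h : G) (x : G ⧸ K) :
    cosetCocycle K (g * h) x = cosetCocycle K g (h • x) * cosetCocycle K h x := by
  ext1
  simp [cosetCocycle, mul_smul, mul_assoc]

end Cosets

/-- Let `K` be a subgroup of `G`. The preimage of `K` under the retraction `G ∗ F(S) → G` is the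
free product of `K` and the free group on the conjugates of `S` by coset representatives; here only
the embedding into that free product is needed. -/
theorem SchickD.comap_fst {G S : Type u} [Group G] (K : Subgroup G)
    (h : SchickD (K ∗ FreeGroup (S × (G ⧸ K)))) :
    SchickD (K.comap (fst : G ∗ FreeGroup S →* G)) := by
  let W := K ∗ FreeGroup (S × (G ⧸ K))
  let κ : G → G ⧸ K → W := fun g x => inl (cosetCocycle K g x)
  have hκ : ∀ g h x, κ (g * h) x = κ g (h • x) * κ h x := fun g h x => by
    simp only [κ, cosetCocycle_mul, map_mul]
  let c : S → G ⧸ K → W := fun s x => inr (FreeGroup.of (s, x))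
  let ψ : W →* G ∗ FreeGroup S := Coprod.lift (inl.comp K.subtype) (FreeGroup.lift fun q =>
    (inl (cosetRep K q.2))⁻¹ * inr (FreeGroup.of q.1) * inl (cosetRep K q.2))
  have hψ1 : ∀ k : K, ψ (inl k) = inl (k : G) := fun k => rfl
  have hψ2 : ∀ q, ψ (inr (FreeGroup.of q)) =
      (inl (cosetRep K q.2))⁻¹ * inr (FreeGroup.of q.1) * inl (cosetRep K q.2) := fun q =>
    (Coprod.lift_apply_inr _ _ _).trans FreeGroup.lift_apply_of
  let Ψ : (G ⧸ K) × W → G ∗ FreeGroup S := fun y => inl (cosetRep K y.1) * ψ y.2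
  have hΨ := coprodPerm_equivariant κ hκ c Ψ
    (fun g y => by simp [Ψ, κ, hψ1, cosetCocycle, mul_assoc])
    (fun s y => by simp [Ψ, c, hψ2, mul_assoc])
  let x₀ : G ⧸ K := (1 : G)
  have hx₀ : ∀ u : K.comap (fst : G ∗ FreeGroup S →* G), fst u.1 • x₀ = x₀ := fun u => by
    change ((fst u.1 * 1 : G) : G ⧸ K) = (1 : G)
    rw [QuotientGroup.eq, mul_one, mul_one]
    exact inv_mem u.2
  let f : K.comap (fst : G ∗ FreeGroup S →* G) →* W :=
    MonoidHom.mk' (fun u => (coprodPerm κ hκ c u.1 (x₀, 1)).2) fun u v => by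
      have h1 : coprodPerm κ hκ c v.1 (x₀, 1) = (x₀, 1 * (coprodPerm κ hκ c v.1 (x₀, 1)).2) :=
        Prod.ext ((coprodPerm_fst κ hκ c v.1 _).trans (hx₀ v)) (one_mul _).symm
      rw [Subgroup.coe_mul, map_mul, Equiv.Perm.mul_apply, h1, coprodPerm_mul_right]
      simp
  refine .subgroup f ?_ h
  rw [injective_iff_map_eq_one]
  intro u hu
  have h1 : coprodPerm κ hκ c u.1 (x₀, 1) = (x₀, 1) :=
    Prod.ext ((coprodPerm_fst κ hκ c u.1 _).trans (hx₀ u)) hu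
  have h2 := hΨ u.1 (x₀, 1)
  rw [h1] at h2
  exact Subtype.ext (mul_eq_right.1 h2.symm)

section KernelOfRetraction

variable {G S : Type*} [Group G]

/-- The homomorphism from the free group on `S × G` onto the kernel of the retraction
`G ∗ F(S) → G`, sending `(s, g)` to `g⁻¹ s g`. -/
def conjugatesHom : FreeGroup (S × G) →* G ∗ FreeGroup S :=
  FreeGroup.lift fun q => (inl q.2)⁻¹ * inr (FreeGroup.of q.1) * inl q.2

/-- The kernel of the retraction is free on the conjugates `g⁻¹ s g`. Both halves come from the action
of `G ∗ F(S)` on `G × F(S × G)` in which `G` translates the first factor and a generator `s`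
multiplies the fibre over `g` by the letter `(s, g)`. -/
theorem conjugatesHom_spec : Function.Injective (conjugatesHom : FreeGroup (S × G) →* _) ∧
    ∀ u : G ∗ FreeGroup S, fst u = 1 → ∃ y, conjugatesHom y = u := by
  let κ : G → G → FreeGroup (S × G) := fun _ _ => 1
  have hκ : ∀ g h x, κ (g * h) x = κ g (h • x) * κ h x := fun g h x => (one_mul _).symm
  let c : S → G → FreeGroup (S × G) := fun s x => FreeGroup.of (s, x)
  constructor
  · rw [injective_iff_map_eq_one]
    intro y hy
    have h := perm_apply_eq_of_freeGroup ((coprodPerm κ hκ c).comp conjugatesHom) (MonoidHom.id _)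
      (fun w => ((1 : G), w)) (fun l w => by
        have hl : (inl l.2 : G ∗ FreeGroup S)⁻¹ = inl l.2⁻¹ := (map_inv _ _).symm
        simp [conjugatesHom, hl, coprodPerm_inl, coprodPerm_of, κ, c, -map_inv]) y 1
    simpa [hy, eq_comm] using h
  · intro u hu
    have h := coprodPerm_equivariant κ hκ c (fun y => inl y.1 * conjugatesHom y.2)
      (fun g y => by simp [κ, mul_assoc]) (fun s y => by simp [c, conjugatesHom, mul_assoc]) u (1, 1)
    have h1 := coprodPerm_fst κ hκ c u (1, 1)
    rw [h1, hu] at h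
    exact ⟨_, by simpa using h⟩

theorem conjugatesHom_naturality {G' : Type*} [Group G'] (f : G →* G') (y : FreeGroup (S × G)) :
    Coprod.map f (MonoidHom.id (FreeGroup S)) (conjugatesHom y) =
      conjugatesHom (FreeGroup.map (Prod.map id f) y) := by
  suffices h : (Coprod.map f (MonoidHom.id (FreeGroup S))).comp conjugatesHom =
      conjugatesHom.comp (FreeGroup.map (Prod.map id f)) from DFunLike.congr_fun h y
  ext q
  simp [conjugatesHom]

theorem GroupIsTorsionFree.freeGroup (X : Type*) : GroupIsTorsionFree (FreeGroup X) := by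
  intro g hg
  obtain ⟨n, hn, h⟩ := isOfFinOrder_iff_pow_eq_one.1 hg
  exact (pow_eq_one_iff_left hn.ne').1 h

theorem GroupIsTorsionFree.coprod_freeGroup (hG : GroupIsTorsionFree G) :
    GroupIsTorsionFree (G ∗ FreeGroup S) := by
  intro u hu
  obtain ⟨y, rfl⟩ := conjugatesHom_spec.2 u (hG _ (fst.isOfFinOrder hu))
  rw [conjugatesHom_spec.1.isOfFinOrder_iff] at hu
  rw [GroupIsTorsionFree.freeGroup _ y hu, map_one]

theorem FreeGroup.exists_finset_letters {X : Type*} (y : FreeGroup X) :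
    ∃ L : Finset X, y ∈ (FreeGroup.map (Subtype.val : L → X)).range := by
  classical
  induction y using FreeGroup.induction_on with
  | C1 => exact ⟨∅, one_mem _⟩
  | of x => exact ⟨{x}, FreeGroup.of ⟨x, Finset.mem_singleton_self x⟩, by simp⟩
  | inv_of x h => exact h.imp fun L hL => inv_mem hL
  | mul a b ha hb =>
    obtain ⟨L, a, rfl⟩ := ha
    obtain ⟨M, b, rfl⟩ := hb
    refine ⟨L ∪ M, FreeGroup.map (fun x => ⟨x.1, Finset.mem_union_left _ x.2⟩) a *
      FreeGroup.map (fun x => ⟨x.1, Finset.mem_union_right _ x.2⟩) b, ?_⟩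
    rw [_root_.map_mul, FreeGroup.map.comp, FreeGroup.map.comp]
    rfl

/-- The nontriviality of an element of `G ∗ F(S)` is detected by finitely many nontrivial elements
of `G`. -/
theorem exists_finset_map_ne_one {u : G ∗ FreeGroup S} (hu : u ≠ 1) :
    ∃ Q : Finset G, 1 ∉ Q ∧ ∀ {G' : Type u} [Group G'] (f : G →* G'), (∀ q ∈ Q, f q ≠ 1) →
      Coprod.map f (MonoidHom.id (FreeGroup S)) u ≠ 1 := by
  classical
  by_cases h1 : fst u = 1
  · obtain ⟨y, rfl⟩ := conjugatesHom_spec.2 u h1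
    obtain ⟨L, y, rfl⟩ := y.exists_finset_letters
    refine ⟨((L ×ˢ L).image fun q => q.1.2 * q.2.2⁻¹).erase 1, by simp, fun f hf h => hu ?_⟩
    rw [conjugatesHom_naturality, map_eq_one_iff _ conjugatesHom_spec.1, FreeGroup.map.comp,
      map_eq_one_iff] at h
    · rw [h, map_one, map_one]
    · refine FreeGroup.map_injective ?_
      rintro ⟨⟨s, a⟩, ha⟩ ⟨⟨t, b⟩, hb⟩ hab
      simp only [Function.comp_apply, Prod.map_apply, id, Prod.mk.injEq] at hab
      by_contra hne
      refine hf (a * b⁻¹) (Finset.mem_erase.2 ⟨fun h => hne ?_, Finset.mem_image.2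
        ⟨((s, a), (t, b)), Finset.mem_product.2 ⟨ha, hb⟩, rfl⟩⟩) (by simp [hab.2])
      rw [mul_inv_eq_one] at h
      simp [hab.1, h]
  · refine ⟨{fst u}, by simpa [eq_comm] using h1, fun f hf h => hf _ (Finset.mem_singleton_self _) ?_⟩
    have : (fst : _ ∗ FreeGroup S →* _).comp (Coprod.map f (MonoidHom.id _)) = f.comp fst := by
      ext <;> simp
    rw [← MonoidHom.comp_apply, ← this, MonoidHom.comp_apply, h, map_one]

end KernelOfRetraction

/-- The class `𝒟` is closed under free products with free groups, by induction on the membership of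
the first factor. For extensions `SchickD.comap_fst` describes the preimages of finite subgroups; that
subgroups and inverse limits are preserved follows from `exists_finset_map_ne_one`. -/
theorem SchickD.coprod_freeGroup {G : Type u} [Group G] (hG : SchickD G) (S : Type u) :
    SchickD (G ∗ FreeGroup S) := by
  induction hG generalizing S with
  | trivialGroup =>
    refine .subgroup (snd : PUnit ∗ FreeGroup S →* FreeGroup S) ?_ (.freeGroup S)
    refine Function.LeftInverse.injective (g := inr) (DFunLike.congr_fun
      (show (inr.comp snd : PUnit ∗ FreeGroup S →* _) = MonoidHom.id _ from ?_))
    refine hom_ext ?_ rfl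
    ext x
    change inr (snd (inl x)) = inl 1
    rw [snd_apply_inl, map_one, map_one]
  | @extension G A _ _ hG hA p hp _ ih =>
    refine .extension hG.coprod_freeGroup hA (p.comp fst) (hp.comp fst_surjective) fun E hE => ?_
    exact .comap_fst (E.comap p) (ih E hE _)
  | @subgroup G' G _ _ f hf _ ih =>
    refine .subgroup (Coprod.map f (MonoidHom.id (FreeGroup S))) ?_ (ih S)
    rw [injective_iff_map_eq_one]
    intro u hu
    by_contra hne
    obtain ⟨Q, hQ, h⟩ := exists_finset_map_ne_one hne
    exact h f (fun q hq h1 => hQ (by rwa [(map_eq_one_iff f hf).1 h1] at hq)) hu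
  | @directLimit ι _ _ _ K _ f _ _ ih =>
    let f' : ∀ i j : ι, i ≤ j → (K i ∗ FreeGroup S) →* (K j ∗ FreeGroup S) := fun i j h =>
      Coprod.map (f i j h) (MonoidHom.id _)
    have : DirectedSystem (fun i => K i ∗ FreeGroup S) (fun i j h => f' i j h) := by
      constructor
      · intro i
        have h1 : f' i i le_rfl = MonoidHom.id _ := by
          refine hom_ext ?_ rfl
          ext x
          exact congrArg inl (DirectedSystem.map_self' f x)
        exact DFunLike.congr_fun h1
      · intro k j i hij hjk
        have h1 : (f' j k hjk).comp (f' i j hij) = f' i k (hij.trans hjk) := by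
          refine hom_ext ?_ rfl
          ext x
          exact congrArg inl (DirectedSystem.map_map' f hij hjk x)
        exact DFunLike.congr_fun h1
    obtain ⟨i₀⟩ := (inferInstance : Nonempty ι)
    let s : DirectLimit K f ∗ FreeGroup S →* DirectLimit (fun i => K i ∗ FreeGroup S) f' :=
      Coprod.lift (directLimitLift f (fun i => (directLimitMk f' i).comp inl)
        fun i j h x => directLimitMk_map f' h (inl x)) ((directLimitMk f' i₀).comp inr)
    let r : DirectLimit (fun i => K i ∗ FreeGroup S) f' →* DirectLimit K f ∗ FreeGroup S :=
      directLimitLift f' (fun i => Coprod.map (directLimitMk f i) (MonoidHom.id _))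
        fun i j h => DFunLike.congr_fun (show (Coprod.map (directLimitMk f j)
            (MonoidHom.id (FreeGroup S))).comp (f' i j h) = Coprod.map (directLimitMk f i)
            (MonoidHom.id (FreeGroup S)) from by
          refine hom_ext ?_ rfl
          ext x
          exact congrArg inl (directLimitMk_map f h x))
    refine .of_retract _ f' (fun i => ih i S) r s (hom_ext ?_ rfl)
    ext z
    obtain ⟨i, x, rfl⟩ := exists_directLimitMk_eq f z
    rfl
  | @inverseLimit ι _ _ _ K _ f _ _ ih =>
    let f' : ∀ ⦃i j : ι⦄, i ≤ j → (K j ∗ FreeGroup S) →* (K i ∗ FreeGroup S) := fun i j h =>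
      Coprod.map (f h) (MonoidHom.id _)
    have : InverseSystem (fun _ _ h => f' h) := by
      constructor
      · intro i
        have h1 : f' (le_refl i) = MonoidHom.id _ := by
          refine hom_ext ?_ rfl
          ext x
          exact congrArg inl (InverseSystem.map_self (f := fun _ _ h => f h) x)
        exact DFunLike.congr_fun h1
      · intro k j i hkj hji
        have h1 : (f' hkj).comp (f' hji) = f' (hkj.trans hji) := by
          refine hom_ext ?_ rfl
          ext x
          exact congrArg inl (InverseSystem.map_map (f := fun _ _ h => f h) hkj hji x)
        exact DFunLike.congr_fun h1
    refine .of_inverseSystem _ f' (fun i => ih i S)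
      (fun i => Coprod.map ((Pi.evalMonoidHom K i).comp (Subgroup.subtype _)) (MonoidHom.id _))
      (fun i j h => DFunLike.congr_fun (show (f' h).comp (Coprod.map ((Pi.evalMonoidHom K j).comp
          (groupInverseLimit K f).subtype) (MonoidHom.id (FreeGroup S))) =
          Coprod.map ((Pi.evalMonoidHom K i).comp (groupInverseLimit K f).subtype)
            (MonoidHom.id (FreeGroup S)) from by
        refine hom_ext ?_ rfl
        ext x
        exact congrArg inl (x.2 h))) fun u hu => ?_
    by_contra hne
    obtain ⟨Q, hQ, h⟩ := exists_finset_map_ne_one hne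
    have h1 : ∀ q : Q, ∃ i, q.1.1 i ≠ 1 := by
      intro q
      by_contra! hq
      exact hQ ((show q.1 = 1 from Subtype.ext (funext hq)) ▸ q.2)
    choose i hi using h1
    classical
    obtain ⟨m, hm⟩ := (Finset.univ.image i).exists_le
    refine h _ (fun q hq h2 => hi ⟨q, hq⟩ ?_) (hu m)
    have h3 : f (hm (i ⟨q, hq⟩) (Finset.mem_image_of_mem _ (Finset.mem_univ _))) (q.1 m) =
      q.1 (i ⟨q, hq⟩) := q.2 _
    rw [← h3, show q.1 m = 1 from h2, map_one]

open Classical in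
/-- The homomorphism from the free product of the `G i` to the free product of `∏ G i` with the
free group on the index set which conjugates the factor `G i` by the `i`-th free generator. -/
noncomputable def conjugateFactors {ι : Type u} (G : ι → Type u) [∀ i, Group (G i)] :
    CoprodI G →* (∀ i, G i) ∗ FreeGroup ι :=
  CoprodI.lift fun i =>
    (MulAut.conj (inr (FreeGroup.of i))).toMonoidHom.comp (inl.comp (MonoidHom.mulSingle G i))

/-- The free product `∗ G i` acts faithfully by left multiplication on one fibre of
`Option ι × ∗ G i`, when the `i`-th free generator swaps the fibres over `none` and `some i` and
`∏ G i` acts on the fibre over `some i` through its `i`-th coordinate. -/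
theorem conjugateFactors_injective {ι : Type u} (G : ι → Type u) [∀ i, Group (G i)] :
    Function.Injective (conjugateFactors G) := by
  classical
  let _ : MulAction (∀ i, G i) (Option ι) :=
    { smul := fun _ x => x, one_smul := fun _ => rfl, mul_smul := fun _ _ _ => rfl }
  let κ : (∀ i, G i) → Option ι → CoprodI G := fun p x => x.elim 1 fun i => CoprodI.of (p i)
  have hκ : ∀ g h x, κ (g * h) x = κ g (h • x) * κ h x := by
    rintro g h (_ | i)
    · exact (one_mul _).symm
    · exact map_mul CoprodI.of (g i) (h i)
  let θ : (∀ i, G i) ∗ FreeGroup ι →* Equiv.Perm (Option ι × CoprodI G) :=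
    Coprod.lift (cocyclePerm κ hκ) (FreeGroup.lift fun i =>
      (Equiv.swap none (some i)).prodCongr (Equiv.refl _))
  have hθl : ∀ p y, θ (inl p) y = (y.1, κ p y.1 * y.2) := fun p y => rfl
  have hθr : ∀ i y, θ (inr (FreeGroup.of i)) y = (Equiv.swap none (some i) y.1, y.2) :=
    fun i y => by
      simp only [θ, Coprod.lift_apply_inr, FreeGroup.lift_apply_of]
      rfl
  have key : ∀ y w, θ (conjugateFactors G y) (none, w) = (none, y * w) := by
    intro y
    induction y using CoprodI.induction_on with
    | one => simp
    | of i m =>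
      intro w
      have h1 : (inr (FreeGroup.of i) : (∀ i, G i) ∗ FreeGroup ι)⁻¹ = inr (FreeGroup.of i)⁻¹ :=
        (map_inv _ _).symm
      have h2 : (θ (inr (FreeGroup.of i)))⁻¹ (none, w) = (some i, w) := by
        rw [Equiv.Perm.inv_eq_iff_eq, hθr, Equiv.swap_apply_right]
      have h3 : conjugateFactors G (CoprodI.of m) =
          inr (FreeGroup.of i) * inl (Pi.mulSingle i m) * (inr (FreeGroup.of i))⁻¹ := by
        simp [conjugateFactors]
      rw [h3, map_mul, map_mul, map_inv, Equiv.Perm.mul_apply, Equiv.Perm.mul_apply, h2, hθl, hθr]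
      simp [κ]
    | mul a b ha hb =>
      intro w
      rw [map_mul, map_mul, Equiv.Perm.mul_apply, hb, ha, mul_assoc]
  rw [injective_iff_map_eq_one]
  intro y hy
  have h1 := key y 1
  rw [hy, map_one, Equiv.Perm.one_apply, mul_one] at h1
  exact (Prod.ext_iff.1 h1).2.symm

theorem SchickD.coprodI {ι : Type u} (G : ι → Type u) [∀ i, Group (G i)]
    (h : ∀ i, SchickD (G i)) : SchickD (CoprodI G) :=
  .subgroup (conjugateFactors G) (conjugateFactors_injective G)
    ((SchickD.pi G h).coprod_freeGroup ι)

/-! ### Torsion in extensions of free groups by groups of prime order -/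

open Module

section FoxBasis

variable (X : Type*) (k : Type*) [Field k]

/-- The affine action of the free group on the edge module of its Cayley graph, in which a
generator `x` acts by translating edges and adding the edge from `1` to `x`. -/
noncomputable def edgePerm :
    FreeGroup X →* Equiv.Perm (FreeGroup X × X →₀ k) :=
  FreeGroup.lift fun x =>
    ((Finsupp.domLCongr (R := k) (M := k)
      ((Equiv.mulLeft (FreeGroup.of x)).prodCongr (Equiv.refl X))).toEquiv).trans
      (Equiv.addRight (Finsupp.single (1, x) 1))

/-- Left translation of edges. -/
noncomputable def edgeTranslate (g : FreeGroup X) :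
    (FreeGroup X × X →₀ k) →ₗ[k] (FreeGroup X × X →₀ k) :=
  Finsupp.lmapDomain k k (Prod.map (g * ·) id)

theorem edgeTranslate_mul (g h : FreeGroup X) (m : FreeGroup X × X →₀ k) :
    edgeTranslate X k (g * h) m = edgeTranslate X k g (edgeTranslate X k h m) := by
  simp only [edgeTranslate, Finsupp.lmapDomain_apply, ← Finsupp.mapDomain_comp]
  congr 1
  ext1 ⟨a, x⟩
  simp [mul_assoc]

theorem edgeTranslate_one (m : FreeGroup X × X →₀ k) : edgeTranslate X k 1 m = m := by
  have : (Prod.map (fun x : FreeGroup X => 1 * x) (id : X → X)) = id := by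
    ext1 ⟨a, x⟩
    simp
  rw [edgeTranslate, this, Finsupp.lmapDomain_id, LinearMap.id_apply]

theorem edgePerm_apply (g : FreeGroup X) (m : FreeGroup X × X →₀ k) :
    edgePerm X k g m = edgeTranslate X k g m + edgePerm X k g 0 := by
  induction g using FreeGroup.induction_on generalizing m with
  | C1 => simp [edgeTranslate_one]
  | of x =>
    simp [edgePerm, edgeTranslate, Finsupp.domLCongr, Finsupp.domCongr,
      Finsupp.equivMapDomain_eq_mapDomain]
  | inv_of x h =>
    have h1 : ∀ m, edgePerm X k (FreeGroup.of x) (edgePerm X k (FreeGroup.of x)⁻¹ m) = m := by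
      intro m
      rw [map_inv, ← Equiv.Perm.mul_apply, mul_inv_cancel, Equiv.Perm.one_apply]
    apply (edgePerm X k (FreeGroup.of x)).injective
    rw [h1, h, map_add, add_assoc, ← h, h1, add_zero, ← edgeTranslate_mul, mul_inv_cancel,
      edgeTranslate_one]
  | mul a b ha hb =>
    rw [map_mul, Equiv.Perm.mul_apply, hb, ha, map_add, edgeTranslate_mul, Equiv.Perm.mul_apply,
      ha (edgePerm X k b 0), add_assoc]

/-- The vector of `k[F(X)]` given by the boundary of an edge of the Cayley graph, and the base
vertex for `none`. -/
noncomputable def foxVector : Option (FreeGroup X × X) → (FreeGroup X →₀ k)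
  | none => Finsupp.single 1 1
  | some q => Finsupp.single (q.1 * FreeGroup.of q.2) 1 - Finsupp.single q.1 1

/-- The group algebra of a free group has a basis consisting of the base vertex and the boundaries
of the edges of the Cayley graph, because the Cayley graph is a tree: the unique path from `1` to
`g` provides the coordinates of `g`. -/
theorem exists_foxBasis :
    ∃ b : Basis (Option (FreeGroup X × X)) k (FreeGroup X →₀ k), ⇑b = foxVector X k := by
  let P : (Option (FreeGroup X × X) →₀ k) →ₗ[k] (FreeGroup X →₀ k) :=
    Finsupp.linearCombination k (foxVector X k)
  let I : (FreeGroup X × X →₀ k) →ₗ[k] (Option (FreeGroup X × X) →₀ k) :=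
    Finsupp.lmapDomain k k some
  let D : (FreeGroup X →₀ k) →ₗ[k] (Option (FreeGroup X × X) →₀ k) :=
    Finsupp.linearCombination k fun g => Finsupp.single none 1 + I (edgePerm X k g 0)
  have hcoc : ∀ g h, edgePerm X k (g * h) 0 =
      edgeTranslate X k g (edgePerm X k h 0) + edgePerm X k g 0 := fun g h => by
    rw [map_mul, Equiv.Perm.mul_apply, edgePerm_apply]
  have hof : ∀ x, edgePerm X k (FreeGroup.of x) 0 = Finsupp.single (1, x) 1 := fun x => by
    simp [edgePerm]
  have hPI : ∀ g m, P (I (edgeTranslate X k g m)) =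
      Finsupp.lmapDomain k k (g * ·) (P (I m)) := by
    intro g m
    refine DFunLike.congr_fun (show (P ∘ₗ I ∘ₗ edgeTranslate X k g) =
      (Finsupp.lmapDomain k k (g * ·)) ∘ₗ P ∘ₗ I from ?_) m
    ext1 q
    ext1
    simp [P, I, edgeTranslate, foxVector, Finsupp.mapDomain_single, Finsupp.mapDomain_sub, mul_assoc]
  have hpath : ∀ g, P (I (edgePerm X k g 0)) = Finsupp.single g 1 - Finsupp.single 1 1 := by
    intro g
    induction g using FreeGroup.induction_on with
    | C1 => simp
    | of x => simp [hof, P, I, foxVector]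
    | inv_of x h =>
      have h1 := hcoc (FreeGroup.of x)⁻¹ (FreeGroup.of x)
      rw [inv_mul_cancel, map_one, Equiv.Perm.one_apply] at h1
      have h2 := congrArg (fun z => P (I z)) h1
      simp only [map_add, map_zero, hPI, h] at h2
      rw [eq_comm, add_comm, add_eq_zero_iff_eq_neg] at h2
      rw [h2]
      simp [Finsupp.mapDomain_sub, Finsupp.mapDomain_single]
    | mul a b ha hb =>
      rw [hcoc, map_add, map_add, hPI, ha, hb]
      simp [Finsupp.mapDomain_sub, Finsupp.mapDomain_single]
  have h1 : P ∘ₗ D = LinearMap.id := by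
    ext1 g
    ext1
    have : P (Finsupp.single none 1) = Finsupp.single 1 1 := by simp [P, foxVector]
    simp [D, hpath, this]
  have h2 : D ∘ₗ P = LinearMap.id := by
    ext1 q
    ext1
    rcases q with _ | ⟨g, x⟩
    · simp [P, D, foxVector]
    · have h3 := hcoc g (FreeGroup.of x)
      rw [hof, edgeTranslate, Finsupp.lmapDomain_apply, Finsupp.mapDomain_single] at h3
      have h4 : P (Finsupp.single (some (g, x)) 1) =
          Finsupp.single (g * FreeGroup.of x) 1 - Finsupp.single g 1 := by simp [P, foxVector]
      simp only [LinearMap.comp_apply, Finsupp.lsingle_apply, h4, map_sub, D,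
        Finsupp.linearCombination_single, one_smul, h3, map_add]
      simp [I]
  refine ⟨Basis.ofRepr (LinearEquiv.ofLinearMap D P h2 h1), ?_⟩
  ext1 q
  simp [P, LinearEquiv.ofLinearMap]

end FoxBasis

section Triangular

variable {k B C : Type*} [Field k] [AddCommGroup C] [Module k C]

/-- A bounded unitriangular perturbation of a basis is a basis, as the base change is unipotent. -/
theorem exists_basis_of_unitriangular (b : Basis B k C) (b' : B → C) (deg : B → ℕ) (n : ℕ)
    (hdeg : ∀ β, deg β < n) (h1 : ∀ β, b.repr (b' β) β = 1)
    (h2 : ∀ β γ, b.repr (b' β) γ ≠ 0 → γ = β ∨ deg β < deg γ) :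
    ∃ c : Basis B k C, ⇑c = b' := by
  let Φ : C →ₗ[k] C := b.constr k b'
  let Ψ : Module.End k C := Φ - 1
  have hΨ : ∀ β γ, b.repr (Ψ (b β)) γ ≠ 0 → deg β < deg γ := by
    intro β γ h
    simp only [Ψ, Φ, LinearMap.sub_apply, Basis.constr_basis, Module.End.one_apply, map_sub,
      Basis.repr_self, Finsupp.sub_apply] at h
    by_cases hγ : γ = β
    · subst hγ
      simp [h1] at h
    · rw [Finsupp.single_eq_of_ne hγ, sub_zero] at h
      exact (h2 β γ h).resolve_left hγ
  have hpow : ∀ m v γ, b.repr ((Ψ ^ m) v) γ ≠ 0 → m ≤ deg γ := by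
    intro m
    induction m with
    | zero => intros; exact Nat.zero_le _
    | succ m ih =>
      intro v γ h
      rw [pow_succ', Module.End.mul_apply, ← b.linearCombination_repr ((Ψ ^ m) v),
        Finsupp.linearCombination_apply, Finsupp.sum, map_sum, map_sum, Finsupp.finsetSum_apply] at h
      obtain ⟨β, _, hβ⟩ := Finset.exists_ne_zero_of_sum_ne_zero h
      rw [map_smul, map_smul, Finsupp.smul_apply, smul_eq_mul] at hβ
      exact (ih v β (left_ne_zero_of_mul hβ)).trans_lt (hΨ β γ (right_ne_zero_of_mul hβ))
  have hnil : IsNilpotent Ψ := by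
    refine ⟨n, LinearMap.ext fun v => b.repr.injective (Finsupp.ext fun γ => ?_)⟩
    by_contra h
    exact (hpow n v γ (by simpa using h)).not_gt (hdeg γ)
  have hu : IsUnit Φ := by
    have := hnil.isUnit_one_add
    rwa [add_sub_cancel] at this
  refine ⟨b.map (LinearEquiv.ofBijective Φ ((Module.End.isUnit_iff _).1 hu)), ?_⟩
  ext1 β
  simp [Φ]

end Triangular

/-- An action admits a map to the group which is equivariant where the action is free. -/
theorem exists_equivariant_of_free {W Z : Type*} [Group W] [MulAction W Z] (s : Set Z)
    (hfree : ∀ (w : W), ∀ z ∈ s, w • z = z → w = 1) :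
    ∃ τ : Z → W, ∀ (w : W), ∀ z ∈ s, τ (w • z) = w * τ z := by
  let o : Z → Z := fun z => (Quotient.mk (MulAction.orbitRel W Z) z).out
  have h : ∀ z : Z, ∃ w : W, w • o z = z := fun z =>
    MulAction.orbitRel_apply.1 (Quotient.exact (s := MulAction.orbitRel W Z) (Quotient.out_eq _).symm)
  choose τ hτ using h
  refine ⟨τ, fun w z hz => ?_⟩
  have h1 : o (w • z) = o z := congrArg Quotient.out
    (Quotient.sound (s := MulAction.orbitRel W Z) (MulAction.orbitRel_apply.2 ⟨w, rfl⟩))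
  have h2 : τ (w • z) • o z = w • z := h1 ▸ hτ (w • z)
  have h3 : (τ z * ((τ (w • z))⁻¹ * w)) • z = z := by
    rw [mul_smul, mul_smul, inv_smul_eq_iff.2 h2.symm, hτ]
  have h4 : (τ (w • z))⁻¹ * w = (τ z)⁻¹ := eq_inv_of_mul_eq_one_right (hfree _ z hz h3)
  rw [inv_mul_eq_iff_eq_mul, eq_mul_inv_iff_mul_eq] at h4
  exact h4.symm

section Coinduced

/-- A function on left cosets, moved by a group element and twisted by a cocycle: the action of
the group on a coinduced set. -/
def coindSmul {W T P Z : Type*} [Group W] [MulAction W T] (κ : W → T → P) (act : P → Z → Z)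
    (w : W) (β : T → Z) : T → Z := fun t => act (κ w (w⁻¹ • t)) (β (w⁻¹ • t))

variable {W T P Z : Type*} [Group W] [MulAction W T] [Group P] {κ : W → T → P}
  (hκ : ∀ g h x, κ (g * h) x = κ g (h • x) * κ h x) {act : P → Z → Z}
  (hact : ∀ g h z, act (g * h) z = act g (act h z))

include hκ hact in
theorem coindSmul_mul (w v : W) (β : T → Z) :
    coindSmul κ act (w * v) β = coindSmul κ act w (coindSmul κ act v β) := by
  funext t
  simp only [coindSmul, hκ, hact, mul_inv_rev, mul_smul, smul_inv_smul]

include hκ in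
theorem coindSmul_one (hact1 : ∀ z, act 1 z = z) (β : T → Z) : coindSmul κ act 1 β = β := by
  have h1 : ∀ x, κ 1 x = 1 := fun x => by
    have := hκ 1 1 x
    rwa [one_smul, mul_one, left_eq_mul] at this
  funext t
  simp [coindSmul, h1, hact1]

/-- The action on a coinduced set. -/
@[reducible]
def coindAction (hact1 : ∀ z, act 1 z = z) : MulAction W (T → Z) where
  smul := coindSmul κ act
  one_smul := coindSmul_one hκ hact1
  mul_smul := coindSmul_mul hκ hact

end Coinduced

section TensorInduction

variable {W T P : Type*} [Group W] [MulAction W T] [Group P] (κ : W → T → P) (k : Type*) [Field k]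

/-- Left translation on the group algebra. -/
noncomputable def leftTranslate (g : P) : (P →₀ k) →ₗ[k] (P →₀ k) := Finsupp.lmapDomain k k (g * ·)

theorem leftTranslate_mul (g h : P) (z : P →₀ k) :
    leftTranslate k (g * h) z = leftTranslate k g (leftTranslate k h z) := by
  simp only [leftTranslate, Finsupp.lmapDomain_apply, ← Finsupp.mapDomain_comp]
  congr 1
  ext1 a
  simp [mul_assoc]

theorem leftTranslate_one (z : P →₀ k) : leftTranslate k (1 : P) z = z := by
  simp only [leftTranslate, Finsupp.lmapDomain_apply, one_mul]
  exact Finsupp.mapDomain_id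

/-- The tensor induced action on the tensor power, over the set of cosets, of the group algebra. -/
noncomputable def tensorInducedMap (w : W) :
    (PiTensorProduct k fun _ : T => (P →₀ k)) →ₗ[k] (PiTensorProduct k fun _ : T => (P →₀ k)) :=
  PiTensorProduct.lift (((PiTensorProduct.tprod k).compLinearMap fun t =>
    leftTranslate k (κ w (w⁻¹ • t))).domDomCongr (MulAction.toPerm w).symm)

theorem tensorInducedMap_tprod (w : W) (a : T → P →₀ k) :
    tensorInducedMap κ k w (PiTensorProduct.tprod k a) =
      PiTensorProduct.tprod k (coindSmul κ (fun g z => leftTranslate k g z) w a) := by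
  rw [tensorInducedMap, PiTensorProduct.lift.tprod]
  rfl

/-- The tensor induced representation. -/
noncomputable def tensorInduced (hκ : ∀ g h x, κ (g * h) x = κ g (h • x) * κ h x) :
    W →* Module.End k (PiTensorProduct k fun _ : T => (P →₀ k)) where
  toFun := tensorInducedMap κ k
  map_one' := by
    ext a
    simp [tensorInducedMap_tprod,
      coindSmul_one hκ (act := fun g z => leftTranslate k g z) (leftTranslate_one k)]
  map_mul' w v := by
    ext a
    simp [tensorInducedMap_tprod,
      coindSmul_mul hκ (act := fun g z => leftTranslate k g z) (leftTranslate_mul k)]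

theorem tensorInduced_tprod (hκ : ∀ g h x, κ (g * h) x = κ g (h • x) * κ h x) (w : W)
    (a : T → P →₀ k) : tensorInduced κ k hκ w (PiTensorProduct.tprod k a) =
      PiTensorProduct.tprod k (coindSmul κ (fun g z => leftTranslate k g z) w a) :=
  tensorInducedMap_tprod κ k w a

end TensorInduction

/-- Let `F` be a free normal subgroup of finite index in the torsion-free group `W`. The tensor power
of the group algebra of `F` over the set of cosets of `F` carries the tensor induced representation
of `W` and has two bases. The first, formed by the tensor products of group elements, is permuted
freely by `W`. The second consists of a vector `b β₀` on which the augmentation `ε` is `1` and of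
vectors which are permuted freely by `W` and killed by `ε`; it comes from the basis of the group
algebra of `F` formed by `1` and the differences `g x - g`. (This is the argument by which a
torsion-free group that is virtually of finite cohomological dimension has itself finite
cohomological dimension.) -/
theorem exists_permutation_bases {W X : Type u} (k : Type u) [Field k] [Group W]
    (hW : GroupIsTorsionFree W) (F : Subgroup W) [F.Normal] [F.FiniteIndex]
    (e : F ≃* FreeGroup X) :
    ∃ (C : Type u) (_ : AddCommGroup C) (_ : Module k C) (ρ : W →* Module.End k C)
      (ε : C →ₗ[k] k) (Y B : Type u) (_ : MulAction W Y) (_ : MulAction W B)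
      (δ : Basis Y k C) (b : Basis B k C) (β₀ : B),
      (∀ w : W, ∀ y : Y, w • y = y → w = 1) ∧ (∀ w : W, ∀ β, β ≠ β₀ → w • β = β → w = 1) ∧
      (∀ w : W, w • β₀ = β₀) ∧
      (∀ w y, ρ w (δ y) = δ (w • y)) ∧ (∀ w β, β ≠ β₀ → ρ w (b β) = b (w • β)) ∧
      (∀ y, ε (δ y) = 1) ∧ ε (b β₀) = 1 ∧ (∀ β, β ≠ β₀ → ε (b β) = 0) := by
  classical
  let T := W ⧸ F
  let P := FreeGroup X
  have : Fintype T := Subgroup.fintypeQuotientOfFiniteIndex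
  let κ : W → T → P := fun w t => e (cosetCocycle F w t)
  have hκ : ∀ g h x, κ (g * h) x = κ g (h • x) * κ h x := fun g h x => by
    simp only [κ, cosetCocycle_mul, map_mul]
  -- an element acting trivially on the cosets and having a trivial cocycle value is trivial
  have hκ1 : ∀ (w : W) (t : T), w ∈ F → κ w t = 1 → w = 1 := by
    intro w t hw h
    have h1 : w • t = t := by
      induction t using QuotientGroup.induction_on with
      | H v =>
        refine QuotientGroup.eq.2 ?_
        have := Subgroup.Normal.conj_mem inferInstance w⁻¹ (inv_mem hw) v⁻¹
        simpa [mul_assoc] using this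
    have h2 : cosetCocycle F w t = 1 := e.injective (by simpa [κ] using h)
    have h3 := congrArg Subtype.val h2
    simp only [cosetCocycle, h1, OneMemClass.coe_one] at h3
    rw [inv_mul_eq_one] at h3
    exact (mul_eq_right.1 h3.symm)
  -- `W` acts freely at all functions with a value at which the free group acts freely, because a
  -- stabilizer meets the subgroup `F` of finite index trivially and `W` is torsion-free
  have hfree : ∀ {Z : Type u} (act : P → Z → Z) (hact : ∀ g h z, act (g * h) z = act g (act h z))
      (hact1 : ∀ z, act 1 z = z) (w : W) (β : T → Z) (t : T)
      (_ : ∀ g, act g (β t) = β t → g = 1), coindSmul κ act w β = β → w = 1 := by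
    intro Z act hact hact1 w β t ht hw
    have hpow : ∀ n : ℕ, coindSmul κ act (w ^ n) β = β := by
      intro n
      induction n with
      | zero => rw [pow_zero, coindSmul_one hκ hact1]
      | succ n ih => rw [pow_succ, coindSmul_mul hκ hact, hw, ih]
    obtain ⟨n, hn, hwn⟩ : ∃ n, n ≠ 0 ∧ w ^ n ∈ F :=
      ⟨F.index, Subgroup.FiniteIndex.index_ne_zero, F.pow_index_mem w⟩
    refine hW.eq_one_of_pow_eq_one hn (hκ1 _ ((w ^ n)⁻¹ • t) hwn (ht _ ?_))
    have h1 := congrFun (hpow n) t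
    have h2 : (w ^ n)⁻¹ • t = t := by
      induction t using QuotientGroup.induction_on with
      | H v =>
        refine QuotientGroup.eq.2 ?_
        have := Subgroup.Normal.conj_mem inferInstance _ hwn v⁻¹
        simpa [mul_assoc] using this
    simpa only [coindSmul, h2] using h1
  obtain ⟨c, hc⟩ := exists_foxBasis X k
  have hc1 : ∀ g : P, c.repr (Finsupp.single g 1) none = 1 := by
    have h : c.coord none = Finsupp.linearCombination k (fun _ : P => (1 : k)) := by
      refine c.ext fun q => ?_
      rw [Basis.coord_apply, Basis.repr_self]
      rcases q with _ | q <;> simp [hc, foxVector]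
    intro g
    rw [← Basis.coord_apply, h]
    simp
  -- the actions of the free group on the set of basis vectors and on its group algebra
  let actO : P → Option (P × X) → Option (P × X) := fun g => Option.map (Prod.map (g * ·) id)
  have hactO : ∀ g h z, actO (g * h) z = actO g (actO h z) := by
    rintro g h (_ | ⟨a, x⟩)
    · rfl
    · simp [actO, mul_assoc]
  have hactO1 : ∀ z, actO 1 z = z := by
    rintro (_ | ⟨a, x⟩)
    · rfl
    · simp [actO]
  -- the translate of a basis vector is the translated basis vector, up to edges in the case of the
  -- base vertex
  have hrep1 : ∀ g q, c.repr (leftTranslate k g (c q)) (actO g q) = 1 := by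
    rintro g (_ | ⟨a, x⟩)
    · simpa [leftTranslate, actO, hc, foxVector] using hc1 g
    · have : leftTranslate k g (c (some (a, x))) = c (some (g * a, x)) := by
        simp [leftTranslate, hc, foxVector, Finsupp.mapDomain_sub, mul_assoc]
      rw [this, Basis.repr_self]
      simp [actO]
  have hrep2 : ∀ g q z, c.repr (leftTranslate k g (c q)) z ≠ 0 →
      z = actO g q ∨ (actO g q = none ∧ z ≠ none) := by
    rintro g (_ | ⟨a, x⟩) z hz
    · by_cases h : z = none
      · exact Or.inl h
      · exact Or.inr ⟨rfl, h⟩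
    · have : leftTranslate k g (c (some (a, x))) = c (some (g * a, x)) := by
        simp [leftTranslate, hc, foxVector, Finsupp.mapDomain_sub, mul_assoc]
      rw [this, Basis.repr_self, Finsupp.single_apply_ne_zero] at hz
      exact Or.inl hz.1
  let aY : MulAction W (T → P) := coindAction (act := fun g z => g * z) hκ mul_assoc one_mul
  let aB : MulAction W (T → Option (P × X)) := coindAction hκ hactO hactO1
  let C := PiTensorProduct k fun _ : T => (P →₀ k)
  let ρ : W →* Module.End k C := tensorInduced κ k hκ
  let δ : Basis (T → P) k C := Basis.piTensorProduct fun _ : T => Finsupp.basisSingleOne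
  let b₀ : Basis (T → Option (P × X)) k C := Basis.piTensorProduct fun _ : T => c
  let β₀ : T → Option (P × X) := fun _ => none
  have hδ' : ∀ y : T → P, δ y = PiTensorProduct.tprod k fun t => Finsupp.single (y t) 1 :=
    fun y => (Basis.piTensorProduct_apply _ _).trans (by simp)
  have hb₀' : ∀ β, b₀ β = PiTensorProduct.tprod k fun t => c (β t) :=
    fun β => Basis.piTensorProduct_apply _ _
  have hrepr : ∀ (a : T → P →₀ k) γ, b₀.repr (PiTensorProduct.tprod k a) γ =
      ∏ t, c.repr (a t) (γ t) := fun a γ => Basis.piTensorProduct_repr_tprod_apply _ _ _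
  have hρt : ∀ w (a : T → P →₀ k), ρ w (PiTensorProduct.tprod k a) =
      PiTensorProduct.tprod k (coindSmul κ (fun g z => leftTranslate k g z) w a) :=
    tensorInduced_tprod κ k hκ
  have hβ₀ : ∀ w : W, w • β₀ = β₀ := fun w => rfl
  have hfreeB : ∀ w : W, ∀ β, β ≠ β₀ → w • β = β → w = 1 := by
    intro w β hβ h
    obtain ⟨t, ht⟩ := Function.ne_iff.1 hβ
    refine hfree actO hactO hactO1 w β t (fun g hg => ?_) h
    obtain ⟨⟨a, x⟩, ha⟩ := Option.ne_none_iff_exists'.1 ht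
    rw [ha] at hg
    simpa [actO] using hg
  have hfreeY : ∀ w : W, ∀ y : T → P, w • y = y → w = 1 := by
    intro w y h
    exact hfree (fun g z => g * z) mul_assoc one_mul w y ((1 : W) : W ⧸ F)
      (fun g hg => mul_eq_right.1 hg) h
  -- the tensor products of basis vectors are permuted by `W` up to terms of higher degree, where the
  -- degree is the number of edges; transporting one vector along each free orbit corrects this
  obtain ⟨τ, hτ⟩ := exists_equivariant_of_free {β | β ≠ β₀} fun w β hβ => hfreeB w β hβ
  let b' : (T → Option (P × X)) → C := fun β =>
    if β = β₀ then b₀ β₀ else ρ (τ β) (b₀ ((τ β)⁻¹ • β))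
  have hδ : ∀ w y, ρ w (δ y) = δ (w • y) := by
    intro w y
    rw [hδ', hρt, hδ']
    refine congrArg _ (funext fun t => ?_)
    simp only [coindSmul, leftTranslate, Finsupp.lmapDomain_apply, Finsupp.mapDomain_single]
    rfl
  let deg : (T → Option (P × X)) → ℕ := fun β => (Finset.univ.filter fun t => β t ≠ none).card
  have hmat1 : ∀ w β, b₀.repr (ρ w (b₀ β)) (w • β) = 1 := by
    intro w β
    rw [hb₀', hρt, hrepr]
    exact Finset.prod_eq_one fun t _ => hrep1 _ _
  have hmat2 : ∀ w β γ, b₀.repr (ρ w (b₀ β)) γ ≠ 0 → γ = w • β ∨ deg (w • β) < deg γ := by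
    intro w β γ h
    rw [hb₀', hρt, hrepr] at h
    have h1 : ∀ t, γ t = (w • β) t ∨ ((w • β) t = none ∧ γ t ≠ none) := fun t =>
      hrep2 _ _ _ (Finset.prod_ne_zero_iff.1 h t (Finset.mem_univ t))
    by_cases h2 : γ = w • β
    · exact Or.inl h2
    · obtain ⟨t, ht⟩ := Function.ne_iff.1 h2
      refine Or.inr (Finset.card_lt_card ((Finset.ssubset_iff_of_subset fun s hs => ?_).2
        ⟨t, ?_, ?_⟩))
      · rw [Finset.mem_filter] at hs ⊢
        rcases h1 s with h3 | h3
        · exact ⟨Finset.mem_univ _, h3 ▸ hs.2⟩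
        · exact absurd h3.1 hs.2
      · exact Finset.mem_filter.2 ⟨Finset.mem_univ _, ((h1 t).resolve_left ht).2⟩
      · simp [((h1 t).resolve_left ht).1]
  obtain ⟨b, hb⟩ := exists_basis_of_unitriangular b₀ b' deg (Fintype.card T + 1)
    (fun β => Nat.lt_succ_of_le (Finset.card_le_univ _))
    (fun β => by
      simp only [b']
      split_ifs with h
      · simp [h]
      · simpa using hmat1 (τ β) ((τ β)⁻¹ • β))
    (fun β γ hγ => by
      simp only [b'] at hγ
      split_ifs at hγ with h
      · rw [Basis.repr_self, Finsupp.single_apply_ne_zero] at hγ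
        exact Or.inl (hγ.1.trans h.symm)
      · simpa using hmat2 (τ β) ((τ β)⁻¹ • β) γ hγ)
  have hεδ : ∀ y, b₀.coord β₀ (δ y) = 1 := by
    intro y
    rw [hδ', Basis.coord_apply, hrepr]
    exact Finset.prod_eq_one fun t _ => hc1 _
  have hερ : ∀ w v, b₀.coord β₀ (ρ w v) = b₀.coord β₀ v := fun w v => by
    refine DFunLike.congr_fun (show b₀.coord β₀ ∘ₗ ρ w = b₀.coord β₀ from δ.ext fun y => ?_) v
    rw [LinearMap.comp_apply, hδ, hεδ, hεδ]
  refine ⟨C, inferInstance, inferInstance, ρ, b₀.coord β₀, T → P, T → Option (P × X), aY, aB, δ, b,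
    β₀, hfreeY, hfreeB, hβ₀, hδ, fun w β hβ => ?_, hεδ, ?_, fun β hβ => ?_⟩
  · have h1 : w • β ≠ β₀ := fun h => hβ (by
      rw [← hβ₀ w] at h
      exact MulAction.injective w h)
    simp only [hb, b', if_neg hβ, if_neg h1, hτ w β hβ, map_mul, Module.End.mul_apply]
    rw [mul_inv_rev, mul_smul, inv_smul_smul]
  · simp [hb, b']
  · simp only [hb, b', if_neg hβ, hερ]
    rw [Basis.coord_apply, Basis.repr_self, Finsupp.single_eq_of_ne']
    intro h
    rw [inv_smul_eq_iff, hβ₀] at h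
    exact hβ h

section PrimeIndex

variable {W : Type u} [Group W] {F : Subgroup W} [F.Normal] {u : W} {p : ℕ}

/-- If `u` has prime order `p` modulo `F`, then exactly one of the elements `u ^ m * w` with `m < p` lies
in `F`, provided that some power of `u` moves `w` into `F`. -/
theorem sum_ite_pow_mul_mem (k : Type*) [Semiring k] [DecidablePred (· ∈ F)] (hp : p.Prime)
    (hu : u ∉ F) (hup : u ^ p ∈ F) {w : W} (hw : ∃ m : ℕ, u ^ m * w ∈ F) :
    ∑ m ∈ Finset.range p, (if u ^ m * w ∈ F then (1 : k) else 0) = 1 := by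
  have := Fact.mk hp
  have hord : orderOf (u : W ⧸ F) = p := by
    refine orderOf_eq_prime ?_ ?_
    · rwa [← QuotientGroup.mk_pow, QuotientGroup.eq_one_iff]
    · rwa [Ne, QuotientGroup.eq_one_iff]
  have hmem : ∀ m, u ^ m * w ∈ F ↔ (u : W ⧸ F) ^ m * w = 1 := fun m => by
    rw [← QuotientGroup.eq_one_iff, QuotientGroup.mk_mul, QuotientGroup.mk_pow]
  obtain ⟨m, hm⟩ := hw
  rw [hmem, ← pow_mod_orderOf, hord] at hm
  rw [Finset.sum_eq_single (m % p), if_pos ((hmem _).2 hm)]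
  · intro n hn hne
    refine if_neg fun h => hne ?_
    rw [hmem, ← hm, mul_left_inj] at h
    exact pow_injOn_Iio_orderOf (by simpa [hord] using hn)
      (by simpa [hord] using Nat.mod_lt m hp.pos) h
  · exact fun h => absurd (Finset.mem_range.2 (Nat.mod_lt m hp.pos)) h

/-- If `F` is a free normal subgroup of prime index `p` in a torsion-free group, then the `p`-th
power of an element outside `F` is not a product of commutators of `F`.

Over the field with `p` elements the invariant functional `f` on the first basis of
`exists_permutation_bases` that sums over the cosets to the augmentation `ε` becomes, on the second
basis, a coboundary `g ∘ u - g` up to a multiple of `ε`. The failure of `g` to be invariant under `F`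
is a homomorphism from `F` to the field, and summing over the powers of `u` shows that it takes the
value `1` on `u ^ p`. -/
theorem pow_notMem_commutator_of_forall_exists [IsFreeGroup F] (hW : GroupIsTorsionFree W)
    (hp : p.Prime) (hu : u ∉ F) (hup : u ^ p ∈ F) (hgen : ∀ w, ∃ m : ℕ, u ^ m * w ∈ F) :
    u ^ p ∉ ⁅F, F⁆ := by
  classical
  rw [← Subgroup.map_subtype_commutator]
  rintro ⟨x, hcomm, hx⟩
  obtain rfl : x = ⟨u ^ p, hup⟩ := Subtype.ext hx
  have := Fact.mk hp
  let k := ULift.{u} (ZMod p)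
  have hpk : (p : k) = 0 := by
    exact congrArg ULift.up (ZMod.natCast_self p)
  have hsum : ∀ w, ∑ m ∈ Finset.range p, (if u ^ m * w ∈ F then (1 : k) else 0) = 1 :=
    fun w => sum_ite_pow_mul_mem k hp hu hup (hgen w)
  have : Finite (W ⧸ F) := by
    refine Finite.of_surjective (fun m : Fin p => ((u : W ⧸ F) ^ (m : ℕ))⁻¹) fun t => ?_
    induction t using QuotientGroup.induction_on with
    | H w =>
      obtain ⟨m, hm, h⟩ := Finset.exists_ne_zero_of_sum_ne_zero
        (ne_of_eq_of_ne (hsum w) one_ne_zero)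
      have h1 : u ^ m * w ∈ F := by
        by_contra h2
        exact h (if_neg h2)
      refine ⟨⟨m, Finset.mem_range.1 hm⟩, ?_⟩
      rw [← QuotientGroup.eq_one_iff, QuotientGroup.mk_mul, QuotientGroup.mk_pow] at h1
      exact inv_eq_of_mul_eq_one_right h1
  have : F.FiniteIndex := Subgroup.finiteIndex_of_finite_quotient
  obtain ⟨C, _, _, ρ, ε, Y, B, _, _, δ, b, β₀, hY, hB, hβ₀, hρδ, hρb, hεδ, hεβ₀, hεb⟩ :=
    exists_permutation_bases k hW F (IsFreeGroup.mulEquiv F).symm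
  obtain ⟨τ, hτ⟩ := exists_equivariant_of_free (Set.univ : Set Y) fun w y _ => hY w y
  obtain ⟨σ, hσ⟩ := exists_equivariant_of_free {β : B | β ≠ β₀} fun w β hβ => hB w β hβ
  have hne : ∀ w : W, ∀ β, β ≠ β₀ → w • β ≠ β₀ := fun w β hβ h => hβ (by
    rw [← hβ₀ w] at h
    exact MulAction.injective w h)
  have hερ : ∀ w v, ε (ρ w v) = ε v := fun w v => by
    refine DFunLike.congr_fun (show ε ∘ₗ ρ w = ε from δ.ext fun y => ?_) v
    rw [LinearMap.comp_apply, hρδ, hεδ, hεδ]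
  -- a functional that is invariant under `F` and whose sum over the cosets of `F` is `ε`
  let f : C →ₗ[k] k := δ.constr k fun y => if τ y ∈ F then (1 : k) else 0
  have hfδ : ∀ y, f (δ y) = if τ y ∈ F then 1 else 0 := fun y => δ.constr_basis k _ y
  have hfF : ∀ h ∈ F, ∀ v, f (ρ h v) = f v := fun h hh v => by
    refine DFunLike.congr_fun (show f ∘ₗ ρ h = f from δ.ext fun y => ?_) v
    rw [LinearMap.comp_apply, hρδ, hfδ, hfδ, hτ h y trivial]
    simp only [Subgroup.mul_mem_cancel_left F hh]
  have hfsum : ∀ v, ∑ m ∈ Finset.range p, f (ρ (u ^ m) v) = ε v := fun v => by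
    have := DFunLike.congr_fun
      (show ∑ m ∈ Finset.range p, f ∘ₗ ρ (u ^ m) = ε from δ.ext fun y => ?_) v
    · simpa using this
    · rw [LinearMap.sum_apply, hεδ, ← hsum (τ y)]
      refine Finset.sum_congr rfl fun m _ => ?_
      rw [LinearMap.comp_apply, hρδ, hfδ, hτ _ y trivial]
  let φ : B → k := fun β => f (b β)
  have hφF : ∀ h ∈ F, ∀ β, β ≠ β₀ → φ (h • β) = φ β := fun h hh β hβ => by
    simp only [φ]
    rw [← hρb h β hβ, hfF h hh]
  have hφsum : ∀ β, β ≠ β₀ → ∑ m ∈ Finset.range p, φ (u ^ m • β) = 0 := fun β hβ => by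
    rw [← hεb β hβ, ← hfsum]
    exact Finset.sum_congr rfl fun m _ => by rw [hρb _ β hβ]
  let χ : B → k := fun β => if σ β ∈ F then 1 else 0
  have hχF : ∀ h ∈ F, ∀ β, β ≠ β₀ → χ (h • β) = χ β := fun h hh β hβ => by
    simp only [χ, hσ h β hβ, Subgroup.mul_mem_cancel_left F hh]
  have hχsum : ∀ β, β ≠ β₀ → ∑ m ∈ Finset.range p, χ (u ^ m • β) = 1 := fun β hβ => by
    rw [← hsum (σ β)]
    exact Finset.sum_congr rfl fun m _ => by simp only [χ, hσ _ β hβ]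
  have hinv : ∀ ψ : B → k, (∀ h ∈ F, ∀ β, β ≠ β₀ → ψ (h • β) = ψ β) → ∀ h ∈ F, ∀ m : ℕ,
      ∀ β, β ≠ β₀ → ψ (u ^ m • h • β) = ψ (u ^ m • β) := by
    intro ψ hψ h hh m β hβ
    have : u ^ m • h • β = (u ^ m * h * (u ^ m)⁻¹) • u ^ m • β := by
      simp only [← mul_smul, inv_mul_cancel_right]
    rw [this, hψ _ (Subgroup.Normal.conj_mem inferInstance h hh _) _ (hne _ _ hβ)]
  -- `φ` sums to zero over the cosets of `F`, hence is a coboundary for the free action on `B`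
  -- outside `β₀`: the partial sums `S` are averaged with the weight `χ`
  let S : ℕ → B → k := fun m β => ∑ j ∈ Finset.range m, φ (u ^ j • β)
  let γ : B → k := fun β =>
    if β = β₀ then 0 else -∑ m ∈ Finset.range p, S m β * χ (u ^ m • β)
  have hγF : ∀ h ∈ F, ∀ β, β ≠ β₀ → γ (h • β) = γ β := fun h hh β hβ => by
    simp only [γ, S, if_neg hβ, if_neg (hne h β hβ), hinv χ hχF h hh _ β hβ,
      hinv φ hφF h hh _ β hβ]
  have hγu : ∀ β, β ≠ β₀ → γ (u • β) - γ β = φ β := fun β hβ => by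
    have h1 : ∀ m, S m (u • β) = S (m + 1) β - φ β := fun m => by
      simp only [S, Finset.sum_range_succ', pow_zero, one_smul, pow_succ, mul_smul,
        add_sub_cancel_right]
    have h2 : ∑ m ∈ Finset.range p, S (m + 1) β * χ (u ^ (m + 1) • β) =
        ∑ m ∈ Finset.range p, S m β * χ (u ^ m • β) := by
      have h3 := Finset.sum_range_succ (fun m => S m β * χ (u ^ m • β)) p
      rw [Finset.sum_range_succ'] at h3
      have h4 : S p β = 0 := hφsum β hβ
      have h5 : S 0 β = 0 := Finset.sum_range_zero _
      rwa [h4, h5, zero_mul, zero_mul, add_zero, add_zero] at h3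
    have h6 : ∑ m ∈ Finset.range p, χ (u ^ (m + 1) • β) = 1 := by
      simpa only [← mul_smul, ← pow_succ] using hχsum (u • β) (hne u β hβ)
    simp only [γ, if_neg hβ, if_neg (hne u β hβ), h1]
    simp only [← mul_smul, ← pow_succ, sub_mul, Finset.sum_sub_distrib, h2, ← Finset.mul_sum, h6]
    ring
  let g : C →ₗ[k] k := b.constr k γ
  have hg : ∀ β, g (b β) = γ β := fun β => b.constr_basis k _ β
  have hgβ₀ : g (b β₀) = 0 := by simp [hg, γ]
  -- the failure of `g` to be invariant under `F` is concentrated at `b β₀`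
  let κ : W → k := fun h => g (ρ h (b β₀))
  have hgF : ∀ h ∈ F, ∀ v, g (ρ h v) = g v + κ h * ε v := fun h hh v => by
    refine DFunLike.congr_fun (show g ∘ₗ ρ h = g + κ h • ε from b.ext fun β => ?_) v
    by_cases hβ : β = β₀
    · simp [hβ, hgβ₀, hεβ₀, κ]
    · simp [hεb β hβ, hρb h β hβ, hg, hγF h hh β hβ]
  let c : k := f (b β₀) - κ u
  have hgu : ∀ v, f v = g (ρ u v) - g v + c * ε v := fun v => by
    refine DFunLike.congr_fun (show f = g ∘ₗ ρ u - g + c • ε from b.ext fun β => ?_) v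
    by_cases hβ : β = β₀
    · simp [hβ, hgβ₀, hεβ₀, κ, c]
    · simp only [LinearMap.add_apply, LinearMap.sub_apply, LinearMap.comp_apply,
        LinearMap.smul_apply, hεb β hβ, smul_zero, add_zero, hρb u β hβ, hg, hγu β hβ]
      rfl
  let κF : F →* Multiplicative k := MonoidHom.mk' (fun h => Multiplicative.ofAdd (κ h)) fun x y => by
    rw [← ofAdd_add]
    congr 1
    simp only [κ, Subgroup.coe_mul, map_mul, Module.End.mul_apply]
    rw [hgF x x.2, hερ, hεβ₀, mul_one, add_comm]
  have hκ0 : κ (u ^ p) = 0 := by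
    have h1 : κF ⟨u ^ p, hup⟩ = 1 := Abelianization.commutator_subset_ker κF hcomm
    exact congrArg Multiplicative.toAdd h1
  have hκ1 : κ (u ^ p) = 1 := by
    have h1 := hfsum (b β₀)
    have h2 : ∀ m, f (ρ (u ^ m) (b β₀)) = κ (u ^ (m + 1)) - κ (u ^ m) + c := fun m => by
      simp only [κ, hgu, hερ, hεβ₀, mul_one, pow_succ', map_mul, Module.End.mul_apply]
    -- the constants `c` add up to `p c = 0`
    simp only [h2, Finset.sum_add_distrib, Finset.sum_const, Finset.card_range, nsmul_eq_mul, hpk,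
      zero_mul, add_zero, hεβ₀] at h1
    rw [Finset.sum_range_sub (fun m => κ (u ^ m))] at h1
    simpa [κ, hgβ₀] using h1
  exact zero_ne_one (hκ0.symm.trans hκ1)

/-- If the `p`-th power of an element `u` outside the free normal subgroup `F` is in `⁅F, F⁆`, then
the coset `F u` contains an element of order `p`: by `pow_notMem_commutator_of_forall_exists` the
group generated by `F` and `u` has torsion, and a power of a torsion element lies in `F u`. -/
theorem exists_mul_pow_eq_one_of_pow_mem_commutator [IsFreeGroup F] (hp : p.Prime) (hu : u ∉ F)
    (hcomm : u ^ p ∈ ⁅F, F⁆) : ∃ x ∈ F, (x * u) ^ p = 1 := by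
  have hup : u ^ p ∈ F := Subgroup.commutator_le_left F F hcomm
  let V : Subgroup W := F ⊔ Subgroup.zpowers u
  have hFV : F ≤ V := le_sup_left
  have huV : u ∈ V := Subgroup.mem_sup_right (Subgroup.mem_zpowers u)
  let e : F.subgroupOf V ≃* F := Subgroup.subgroupOfEquivOfLe hFV
  have : IsFreeGroup (F.subgroupOf V) := IsFreeGroup.ofMulEquiv e.symm
  by_contra! hno
  have hFt : ∀ x ∈ F, ∀ n : ℕ, n ≠ 0 → x ^ n = 1 → x = 1 := fun x hx n hn h =>
    congrArg Subtype.val (((GroupIsTorsionFree.freeGroup _).of_injective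
      (IsFreeGroup.mulEquiv F).symm.toMonoidHom
      (IsFreeGroup.mulEquiv F).symm.injective).eq_one_of_pow_eq_one (g := ⟨x, hx⟩) hn
      (Subtype.ext h))
  have hrep : ∀ w ∈ V, ∃ n : ℕ, ∃ x ∈ F, w = x * u ^ n := by
    intro w hw
    obtain ⟨x, hx, y, ⟨m, rfl⟩, hxy⟩ := Subgroup.mem_sup_of_normal_left.1 hw
    refine ⟨(m % p).toNat, x * (u ^ p) ^ (m / p), mul_mem hx (zpow_mem hup _), ?_⟩
    rw [← hxy, mul_assoc, ← zpow_natCast u p, ← zpow_mul, ← zpow_natCast u (m % p).toNat,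
      ← zpow_add, Int.toNat_of_nonneg (Int.emod_nonneg _ (by exact_mod_cast hp.ne_zero)),
      add_comm, Int.emod_add_mul_ediv]
  have hmodF : ∀ x ∈ F, ∀ w : W, ∀ n : ℕ, ∃ y ∈ F, (x * w) ^ n = y * w ^ n := by
    intro x hx w n
    refine ⟨(x * w) ^ n * (w ^ n)⁻¹, ?_, by group⟩
    rw [← QuotientGroup.eq_one_iff]
    simp [(QuotientGroup.eq_one_iff x).2 hx]
  refine pow_notMem_commutator_of_forall_exists (F := F.subgroupOf V) (u := ⟨u, huV⟩)
    (fun y hy => ?_) hp hu hup (fun w => ?_) ?_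
  · by_contra hy1
    obtain ⟨n, hn, hyn⟩ := isOfFinOrder_iff_pow_eq_one.1 hy
    have hyn' : (y : W) ^ n = 1 := congrArg Subtype.val hyn
    obtain ⟨a, x, hx, hxa⟩ := hrep y y.2
    have hpa : ¬ p ∣ a := by
      rintro ⟨b, rfl⟩
      refine hy1 (Subtype.ext (hFt y ?_ n hn.ne' hyn'))
      rw [hxa, pow_mul]
      exact mul_mem hx (pow_mem hup b)
    -- a power of `y` is in the coset `F u`
    obtain ⟨b, c, hbc⟩ : ∃ b c : ℕ, a * b = 1 + p * c := by
      obtain ⟨b, -, hb⟩ := Nat.exists_mul_mod_eq_one_of_coprime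
        ((hp.coprime_iff_not_dvd.2 hpa).symm) hp.one_lt
      exact ⟨b, a * b / p, by rw [← hb, Nat.mod_add_div]⟩
    obtain ⟨z, hz, hzy⟩ := hmodF x hx (u ^ a) b
    rw [← hxa, ← pow_mul, hbc, add_comm, pow_add, pow_one, pow_mul, ← mul_assoc] at hzy
    have hz' : z * (u ^ p) ^ c ∈ F := mul_mem hz (pow_mem hup c)
    refine hno _ hz' (hFt _ ?_ n hn.ne' ?_)
    · obtain ⟨z', hz', h⟩ := hmodF _ hz' u p
      rw [h]
      exact mul_mem hz' hup
    · rw [← hzy, ← pow_mul, ← pow_mul, ← mul_assoc, mul_comm _ n, pow_mul, hyn', one_pow]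
  · obtain ⟨a, x, hx, hxa⟩ := hrep w⁻¹ (inv_mem w.2)
    refine ⟨a, ?_⟩
    rw [Subgroup.mem_subgroupOf]
    have h1 : u ^ a * (w : W) = x⁻¹ := by
      rw [← inv_inj, inv_inv, mul_inv_rev, hxa, mul_inv_cancel_right]
    simpa [h1] using inv_mem hx
  · have h1 := Subgroup.map_commutator (F.subgroupOf V) (F.subgroupOf V) V.subtype
    rw [Subgroup.map_subgroupOf_eq_of_le hFV] at h1
    rw [← h1] at hcomm
    obtain ⟨x, hx, hxu⟩ := hcomm
    rwa [show (⟨u, huV⟩ : V) ^ p = x from Subtype.ext hxu.symm]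

/-- The quotient by a normal subgroup is torsion-free as soon as it has no element of prime order. -/
theorem GroupIsTorsionFree.quotient_of_prime {N : Subgroup W} [N.Normal]
    (h : ∀ u ∉ N, ∀ p : ℕ, p.Prime → u ^ p ∉ N) : GroupIsTorsionFree (W ⧸ N) := by
  intro x hx
  by_contra hx1
  have h0 : orderOf x ≠ 0 := hx.orderOf_pos.ne'
  obtain ⟨p, hp, hpx⟩ := Nat.exists_prime_and_dvd (n := orderOf x)
    (fun h => hx1 (orderOf_eq_one_iff.1 h))
  have hord := orderOf_pow_orderOf_div h0 hpx
  obtain ⟨u, hu⟩ := QuotientGroup.mk_surjective (x ^ (orderOf x / p))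
  rw [← hu] at hord
  refine h u (fun huN => ?_) p hp ?_
  · rw [(QuotientGroup.eq_one_iff u).2 huN, orderOf_one] at hord
    exact hp.one_lt.ne hord
  · rw [← QuotientGroup.eq_one_iff, QuotientGroup.mk_pow, ← hord, pow_orderOf_eq_one]

/-- The abelianization of a free group is free abelian, hence torsion-free. -/
theorem mem_commutator_of_pow_mem {F : Type*} [Group F] [IsFreeGroup F] {x : F} {n : ℕ}
    (hn : n ≠ 0) (h : x ^ n ∈ commutator F) : x ∈ commutator F := by
  rw [← Abelianization.ker_of, MonoidHom.mem_ker] at h ⊢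
  let e := (IsFreeGroup.mulEquiv F).symm.abelianizationCongr
  let e' : Abelianization (FreeGroup (IsFreeGroup.Generators F)) ≃
      (IsFreeGroup.Generators F →₀ ℤ) :=
    Additive.ofMul.trans (FreeAbelianGroup.equivFinsupp (IsFreeGroup.Generators F)).toEquiv
  have he'1 : e' 1 = 0 := (FreeAbelianGroup.equivFinsupp (IsFreeGroup.Generators F)).map_zero
  have he'n : ∀ a, e' (a ^ n) = n • e' a := fun a =>
    map_nsmul (FreeAbelianGroup.equivFinsupp (IsFreeGroup.Generators F)) n (Additive.ofMul a)
  have h1 : n • e' (e (Abelianization.of x)) = 0 := by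
    rw [← he'n, ← map_pow, ← map_pow, h, map_one, he'1]
  have h2 := (smul_eq_zero.1 h1).resolve_left hn
  rw [← he'1] at h2
  exact e.map_eq_one_iff.1 (e'.injective h2)

/-- The quotient of a torsion-free group by the commutator subgroup of a free normal subgroup is
torsion-free. -/
theorem GroupIsTorsionFree.quotient_commutator [IsFreeGroup F] (hW : GroupIsTorsionFree W) :
    GroupIsTorsionFree (W ⧸ ⁅F, F⁆) := by
  refine .quotient_of_prime fun u hu p hp hup => ?_
  by_cases huF : u ∈ F
  · rw [← Subgroup.map_subtype_commutator] at hu hup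
    obtain ⟨x, hx, hxu⟩ := hup
    refine hu ⟨⟨u, huF⟩, mem_commutator_of_pow_mem hp.ne_zero ?_, rfl⟩
    rwa [show (⟨u, huF⟩ : F) ^ p = x from Subtype.ext hxu.symm]
  · obtain ⟨x, hx, hxu⟩ := exists_mul_pow_eq_one_of_pow_mem_commutator hp huF hup
    refine huF ?_
    rw [← inv_eq_of_mul_eq_one_right (hW.eq_one_of_pow_eq_one hp.ne_zero hxu)]
    exact inv_mem hx

end PrimeIndex

/-! ### Linnell's class -/

theorem IsElementaryAmenable.of_ker {G A : Type u} [Group G] [Group A] (p : G →* A)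
    (hp : Function.Surjective p) (hker : IsElementaryAmenable p.ker)
    (hA : IsElementaryAmenable A) : IsElementaryAmenable G :=
  .extension (N := p.ker)
    { inl := p.ker.subtype
      rightHom := p
      inl_injective := p.ker.subtype_injective
      range_inl_eq_ker_rightHom := p.ker.range_subtype
      rightHom_surjective := hp } hker hA

theorem IsElementaryAmenable.quotient_commutator {G : Type u} [Group G] {N : Subgroup G}
    [N.Normal] (h : IsElementaryAmenable (G ⧸ N)) : IsElementaryAmenable (G ⧸ ⁅N, N⁆) := by
  let p : G ⧸ ⁅N, N⁆ →* G ⧸ N :=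
    QuotientGroup.map _ _ (MonoidHom.id G) (Subgroup.commutator_le_left N N)
  have hp : ∀ g : G, p g = g := fun g => rfl
  refine .of_ker p (fun y => ?_) (.ofAbelian ?_) h
  · obtain ⟨g, rfl⟩ := QuotientGroup.mk_surjective y
    exact ⟨g, rfl⟩
  · rintro ⟨a, ha⟩ ⟨b, hb⟩
    obtain ⟨a, rfl⟩ := QuotientGroup.mk_surjective a
    obtain ⟨b, rfl⟩ := QuotientGroup.mk_surjective b
    rw [MonoidHom.mem_ker, hp, QuotientGroup.eq_one_iff] at ha hb
    refine Subtype.ext ?_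
    change ((a * b : G) : G ⧸ ⁅N, N⁆) = (b * a : G)
    rw [QuotientGroup.eq_iff_div_mem]
    have := Subgroup.commutator_mem_commutator ha hb
    rwa [commutatorElement_def, mul_assoc, ← mul_inv_rev, ← div_eq_mul_inv] at this

theorem finiteIndex_ker_subgroupOf_comap {G A : Type*} [Group G] [Group A] (p : G →* A)
    (E : Subgroup A) [Finite E] : (p.ker.subgroupOf (E.comap p)).FiniteIndex := by
  let q : E.comap p →* E := (p.comp (E.comap p).subtype).codRestrict E fun g => g.2
  have hq : q.ker = p.ker.subgroupOf (E.comap p) := by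
    ext g
    rw [MonoidHom.mem_ker, Subgroup.mem_subgroupOf, MonoidHom.mem_ker]
    exact Subtype.ext_iff
  rw [← hq]
  infer_instance

/-- Every torsion-free group with a subgroup of finite index that embeds into a group of Linnell's
class belongs to `𝒟`. This stronger form of the claim is suited to induction: in the case of an
extension the preimages of finite subgroups contain a subgroup of finite index that embeds into the
kernel, but they do not embed into the kernel themselves. -/
theorem LinnellC.schickD_of_finiteIndex {N : Type u} [Group N] (hN : LinnellC N) :
    ∀ (U : Type u) [Group U], GroupIsTorsionFree U → ∀ (H : Subgroup U) [H.FiniteIndex]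
      (f : H →* N), Function.Injective f → SchickD U := by
  induction hN with
  | @free N _ hN =>
    intro U _ hU H _ f hf
    -- `U / ⁅K, K⁆` is torsion-free and abelian-by-finite, with free kernel
    let K := H.normalCore
    have hKH : K ≤ H := H.normalCore_le
    have hK : IsFreeGroup K :=
      IsFreeGroup.ofMulEquiv (MonoidHom.ofInjective (f := f.comp (Subgroup.inclusion hKH))
        (hf.comp (Subgroup.inclusion_injective hKH))).symm
    refine .of_ker (A := U ⧸ ⁅K, K⁆)
      (IsElementaryAmenable.ofFinite (inferInstance : Finite (U ⧸ K))).quotient_commutator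
      hU.quotient_commutator (QuotientGroup.mk' _) (QuotientGroup.mk'_surjective _) ?_
    rw [QuotientGroup.ker_mk']
    exact .subgroup (Subgroup.inclusion (Subgroup.commutator_le_left K K))
      (Subgroup.inclusion_injective _) (.of_isFreeGroup K)
  | @directedUnion N _ ι _ Hi hdir hunion _ ih =>
    intro U _ hU H _ f hf
    refine .of_fg_subgroups fun V hV => ?_
    have : Group.FG V := (Group.fg_iff_subgroup_fg V).2 hV
    let H' : Subgroup V := H.subgroupOf V
    let g : H' →* N := f.comp ((V.subtype.comp H'.subtype).codRestrict H fun x => x.2)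
    have hg : Function.Injective g := fun a b hab =>
      Subtype.ext (Subtype.ext (congrArg (fun x : H => (x : U)) (hf hab)))
    -- by Schreier's lemma
    have : Group.FG H' := Subgroup.fg_of_index_ne_zero H'
    obtain ⟨i, hi⟩ : ∃ i, g.range ≤ Hi i := by
      obtain ⟨S, hS⟩ : g.range.FG := (Group.fg_iff_subgroup_fg _).1 inferInstance
      classical
      choose i hi using hunion
      obtain ⟨m, hm⟩ := hdir.finset_le (S.image i)
      refine ⟨m, hS ▸ (Subgroup.closure_le _).2 fun s hs => ?_⟩
      exact hm _ (Finset.mem_image_of_mem i hs) (hi s)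
    exact ih i V (hU.of_injective V.subtype V.subtype_injective) H'
      (g.codRestrict (Hi i) fun x => hi ⟨x, rfl⟩) fun a b hab => hg (congrArg Subtype.val hab)
  | @extension N G A _ _ _ S _ hA ih =>
    intro U _ hU H _ f hf
    -- `K` is normal of finite index with abelian image in `A`, so `⁅K, K⁆` embeds into `N`
    obtain ⟨B, _, hB⟩ := hA
    let H₁ : Subgroup U := (B.comap (S.rightHom.comp f)).map H.subtype
    have : H₁.FiniteIndex := by
      rw [Subgroup.finiteIndex_iff, Subgroup.index_map_subtype]
      refine mul_ne_zero ?_ Subgroup.FiniteIndex.index_ne_zero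
      rw [Subgroup.index_comap]
      exact Subgroup.FiniteIndex.index_ne_zero (H := B.subgroupOf _)
    let K := H₁.normalCore
    have hKH₁ : K ≤ H₁ := H₁.normalCore_le
    have hKH : K ≤ H := hKH₁.trans (Subgroup.map_subtype_le _)
    have hM : ∀ x (hx : x ∈ ⁅K, K⁆),
        f ⟨x, hKH (Subgroup.commutator_le_left K K hx)⟩ ∈ S.inl.range := by
      have h1 : ⁅K, K⁆ ≤ ((S.rightHom.comp f).ker).map H.subtype := by
        refine Subgroup.commutator_le.2 fun x hx y hy => ?_
        obtain ⟨x, hxB, rfl⟩ := hKH₁ hx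
        obtain ⟨y, hyB, rfl⟩ := hKH₁ hy
        refine ⟨x * y * x⁻¹ * y⁻¹, ?_, map_commutatorElement _ _ _⟩
        have h1 : S.rightHom (f x) * S.rightHom (f y) = S.rightHom (f y) * S.rightHom (f x) :=
          hB _ hxB _ hyB
        rw [SetLike.mem_coe, MonoidHom.mem_ker]
        simp [h1]
      intro x hx
      obtain ⟨y, hy, rfl⟩ := h1 hx
      rw [S.range_inl_eq_ker_rightHom]
      exact hy
    refine .extension hU
      (IsElementaryAmenable.ofFinite (inferInstance : Finite (U ⧸ K))).quotient_commutator
      (QuotientGroup.mk' _) (QuotientGroup.mk'_surjective _) fun E _ => ?_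
    have := finiteIndex_ker_subgroupOf_comap (QuotientGroup.mk' ⁅K, K⁆) E
    rw [QuotientGroup.ker_mk'] at this
    let V := E.comap (QuotientGroup.mk' ⁅K, K⁆)
    let M := ⁅K, K⁆.subgroupOf V
    let g : M →* S.inl.range := (f.comp ((V.subtype.comp M.subtype).codRestrict H fun x =>
      hKH (Subgroup.commutator_le_left K K x.2))).codRestrict _ fun x => hM _ x.2
    have hg : Function.Injective g := fun a b hab =>
      Subtype.ext (Subtype.ext (congrArg (fun x : H => (x : U)) (hf (congrArg Subtype.val hab))))
    exact ih V (hU.of_injective V.subtype V.subtype_injective) M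
      ((MonoidHom.ofInjective S.inl_injective).symm.toMonoidHom.comp g)
      ((MonoidHom.ofInjective S.inl_injective).symm.injective.comp hg)

theorem LinnellC.schickD {G : Type u} [Group G] (hG : LinnellC G) (ht : GroupIsTorsionFree G) :
    SchickD G :=
  hG.schickD_of_finiteIndex G ht ⊤ (⊤ : Subgroup G).subtype (⊤ : Subgroup G).subtype_injective

/-! ### Commuting elements of free groups -/

/-- In a reduced word `z` commuting with a generator `y` the first letter is `y` or its inverse:
otherwise `y z` is reduced, hence so is `z y`, and the two words have different first letters. -/
theorem FreeGroup.head_eq_of_commute {X : Type*} [DecidableEq X] {z : FreeGroup X} {y : X}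
    (h : FreeGroup.of y * z = z * FreeGroup.of y) {s : X × Bool} {l : List (X × Bool)}
    (hz : z.toWord = s :: l) : y = s.1 := by
  by_contra hys
  have h1 : (FreeGroup.of y * z).toWord = (y, true) :: s :: l := by
    rw [FreeGroup.toWord_mul, FreeGroup.toWord_of, List.singleton_append, FreeGroup.reduce.cons,
      FreeGroup.reduce_toWord, hz]
    exact if_neg fun h => hys h.1
  have h2 := FreeGroup.toWord_mul_sublist z (FreeGroup.of y)
  rw [← h, h1, FreeGroup.toWord_of, hz] at h2
  have h3 := h2.eq_of_length (by simp)
  rw [List.cons_append, List.cons.injEq] at h3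
  exact hys (congrArg Prod.fst h3.1)

theorem IsFreeGroup.commute_of_subsingleton {F : Type*} [Group F] [IsFreeGroup F]
    (h : Subsingleton (IsFreeGroup.Generators F)) (x y : F) : Commute x y := by
  have hw : ∀ w v : FreeGroup (IsFreeGroup.Generators F), Commute w v := by
    intro w v
    induction w using FreeGroup.induction_on with
    | C1 => exact Commute.one_left _
    | of a =>
      induction v using FreeGroup.induction_on with
      | C1 => exact Commute.one_right _
      | of b => rw [Subsingleton.elim a b]
      | inv_of b ih => exact ih.inv_right
      | mul v w hv hw => exact hv.mul_right hw
    | inv_of a ih => exact ih.inv_left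
    | mul a b ha hb => exact ha.mul_left hb
  simpa using (hw ((IsFreeGroup.mulEquiv F).symm x) ((IsFreeGroup.mulEquiv F).symm y)).map
    (IsFreeGroup.mulEquiv F)

/-- A free group with nontrivial center is commutative: it has only one generator, the first letter
of any nontrivial central element. -/
theorem IsFreeGroup.commute_of_central {F : Type*} [Group F] [IsFreeGroup F] {z : F} (hz : z ≠ 1)
    (h : ∀ x, Commute z x) (x y : F) : Commute x y := by
  classical
  let e := IsFreeGroup.mulEquiv F
  have hez : e.symm z ≠ 1 := fun h => hz (e.symm.map_eq_one_iff.1 h)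
  obtain ⟨s, l, hsl⟩ := List.exists_cons_of_ne_nil
    (fun h => hez (FreeGroup.toWord_eq_nil_iff.1 h))
  have hs : ∀ a : IsFreeGroup.Generators F, a = s.1 := fun a => by
    refine FreeGroup.head_eq_of_commute (z := e.symm z) ?_ hsl
    have := congrArg e.symm (h (e (FreeGroup.of a))).eq
    simpa using this.symm
  exact IsFreeGroup.commute_of_subsingleton ⟨fun a b => (hs a).trans (hs b).symm⟩ x y

/-- In a free group, commuting is transitive on nontrivial elements, because centralizers are free
groups with nontrivial center. -/
theorem IsFreeGroup.commute_trans {F : Type u} [Group F] [IsFreeGroup F] {x y z : F} (hz : z ≠ 1)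
    (hx : Commute z x) (hy : Commute z y) : Commute x y := by
  let C := Subgroup.centralizer {z}
  have hC : ∀ {x}, Commute z x → x ∈ C := fun h =>
    Subgroup.mem_centralizer_singleton_iff.2 h.eq.symm
  have := IsFreeGroup.commute_of_central (F := C) (z := ⟨z, hC (Commute.refl z)⟩)
    (fun h => hz (congrArg Subtype.val h))
    (fun w => Subtype.ext (Subgroup.mem_centralizer_singleton_iff.1 w.2).symm)
    ⟨x, hC hx⟩ ⟨y, hC hy⟩
  exact congrArg Subtype.val this.eq

/-- The commutator subgroup of a noncommutative free group is not commutative, since the free group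
maps onto the symmetric group of degree four. -/
theorem IsFreeGroup.exists_commutator_not_commute {F : Type*} [Group F] [IsFreeGroup F] {x y : F}
    (hxy : ¬ Commute x y) : ∃ a ∈ commutator F, ∃ b ∈ commutator F, ¬ Commute a b := by
  classical
  obtain ⟨s, t, hst⟩ : ∃ s t : IsFreeGroup.Generators F, s ≠ t := by
    by_contra! hall
    exact hxy (IsFreeGroup.commute_of_subsingleton ⟨hall⟩ x y)
  let f : F →* Equiv.Perm (Fin 4) :=
    IsFreeGroup.lift fun r => if r = s then c[0, 1, 2, 3] else c[0, 1]
  have hs : f (IsFreeGroup.of s) = c[0, 1, 2, 3] := by simp [f]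
  have ht : f (IsFreeGroup.of t) = c[0, 1] := by simp [f, hst.symm]
  refine ⟨_, Subgroup.commutator_mem_commutator (Subgroup.mem_top (IsFreeGroup.of s))
    (Subgroup.mem_top (IsFreeGroup.of t)), _, Subgroup.commutator_mem_commutator
    (Subgroup.mem_top (IsFreeGroup.of s)⁻¹) (Subgroup.mem_top (IsFreeGroup.of t)), fun h => ?_⟩
  have h1 := (h.map f).eq
  simp only [map_commutatorElement, map_inv, hs, ht] at h1
  revert h1
  decide

/-! ### Automorphisms of direct sums of noncommutative free groups -/

/-- A group `M` with homomorphisms `π i` to groups `P i` that exhibit it as the direct sum of its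
images: an element is determined by its coordinates `π i m`, only finitely many of them are
nontrivial, and the endomorphism `e i` of `M` erases all coordinates but the `i`-th. -/
structure DirectSumDecomposition (M : Type*) [Group M] {ι : Type*} (P : ι → Type*)
    [∀ i, Group (P i)] where
  /-- The coordinates. -/
  π : ∀ i, M →* P i
  /-- The projections to the summands. -/
  e : ι → M →* M
  π_e_same : ∀ i m, π i (e i m) = π i m
  π_e_of_ne : ∀ i j, j ≠ i → ∀ m, π j (e i m) = 1
  eq_one : ∀ m, (∀ i, π i m = 1) → m = 1
  finite : ∀ m, {i | π i m ≠ 1}.Finite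

namespace DirectSumDecomposition

section

variable {M : Type*} [Group M] {ι : Type*} {P : ι → Type*} [∀ i, Group (P i)]
  (D : DirectSumDecomposition M P)

theorem ext {a b : M} (h : ∀ i, D.π i a = D.π i b) : a = b := by
  rw [← mul_inv_eq_one]
  refine D.eq_one _ fun i => ?_
  rw [map_mul, map_inv, h, mul_inv_cancel]

theorem e_congr {i : ι} {a b : M} (h : D.π i a = D.π i b) : D.e i a = D.e i b := by
  refine D.ext fun j => ?_
  by_cases hj : j = i
  · subst hj
    rw [D.π_e_same, D.π_e_same, h]
  · rw [D.π_e_of_ne _ _ hj, D.π_e_of_ne _ _ hj]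

theorem commute {i : ι} {a b : M} (ha : ∀ j, j ≠ i → D.π j a = 1) (hb : D.π i b = 1) :
    Commute a b := by
  refine D.ext fun j => ?_
  by_cases hj : j = i
  · subst hj
    simp [hb]
  · simp [ha j hj]

/-- The group is generated by the summands, as supports are finite. -/
theorem mem_of_forall_e_mem (H : Subgroup M) {c : M} (hc : ∀ i, D.e i c ∈ H) : c ∈ H := by
  classical
  suffices ∀ (s : Finset ι) (c : M), (∀ i ∉ s, D.π i c = 1) → (∀ i, D.e i c ∈ H) → c ∈ H from
    this (D.finite c).toFinset c (fun i hi => by simpa using hi) hc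
  intro s
  induction s using Finset.induction_on with
  | empty =>
    intro c hc _
    rw [D.eq_one c fun i => hc i (Finset.notMem_empty i)]
    exact one_mem H
  | insert r s _ ih =>
    intro c hc hH
    have hne : ∀ i, i ≠ r → D.π i ((D.e r c)⁻¹ * c) = D.π i c := fun i hi => by
      rw [map_mul, map_inv, D.π_e_of_ne _ _ hi, inv_one, one_mul]
    have hr : D.π r ((D.e r c)⁻¹ * c) = 1 := by
      rw [map_mul, map_inv, D.π_e_same, inv_mul_cancel]
    rw [← mul_inv_cancel_left (D.e r c) c]
    refine mul_mem (hH r) (ih _ (fun i hi => ?_) fun i => ?_)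
    · by_cases h : i = r
      · rw [h, hr]
      · rw [hne i h]
        exact hc i (by simp [h, hi])
    · by_cases h : i = r
      · subst h
        rw [D.e_congr (b := 1) (by rw [hr, map_one]), map_one]
        exact one_mem H
      · rw [D.e_congr (hne i h)]
        exact hH i

theorem mem_commutator {c : M} (h : ∀ i, ∃ d ∈ commutator M, D.π i c = D.π i d) :
    c ∈ commutator M := by
  refine D.mem_of_forall_e_mem _ fun i => ?_
  obtain ⟨d, hd, hcd⟩ := h i
  rw [D.e_congr hcd]
  have h1 : D.e i d ∈ (commutator M).map (D.e i) := ⟨d, hd, rfl⟩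
  rw [map_commutator_eq] at h1
  exact Subgroup.commutator_mono le_top le_top h1

/-- A homomorphism with noncommutative image in a free group factors through one of the
coordinates: a summand that is not killed and the complementary summand have commuting images, so
the latter has to be killed. -/
theorem exists_forall_eq_one {Q : Type u} [Group Q] [IsFreeGroup Q] (ψ : M →* Q)
    (hψ : ∃ a b, ¬ Commute (ψ a) (ψ b)) : ∃ j, ∀ m, D.π j m = 1 → ψ m = 1 := by
  obtain ⟨a, b, hab⟩ := hψ
  obtain ⟨j, hj⟩ : ∃ j, ψ (D.e j a) ≠ 1 := by
    by_contra! h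
    refine hab ?_
    rw [show ψ a = 1 from D.mem_of_forall_e_mem ψ.ker h]
    exact Commute.one_left _
  refine ⟨j, fun l hl => ?_⟩
  by_contra hl1
  have he : ∀ x y, D.π j y = 1 → Commute (ψ (D.e j x)) (ψ y) := fun x y hy =>
    (D.commute (fun i hi => D.π_e_of_ne _ _ hi x) hy).map ψ
  have hc : ∀ x, D.π j ((D.e j x)⁻¹ * x) = 1 := fun x => by
    rw [map_mul, map_inv, D.π_e_same, inv_mul_cancel]
  have h1 : ∀ x y, Commute (ψ (D.e j x)) (ψ (D.e j y)) := fun x y =>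
    IsFreeGroup.commute_trans hl1 (he x l hl).symm (he y l hl).symm
  have h2 : ∀ x y, D.π j x = 1 → D.π j y = 1 → Commute (ψ x) (ψ y) := fun x y hx hy =>
    IsFreeGroup.commute_trans hj (he a x hx) (he a y hy)
  refine hab ?_
  rw [← mul_inv_cancel_left (D.e j a) a, ← mul_inv_cancel_left (D.e j b) b, map_mul,
    map_mul ψ (D.e j b)]
  exact ((h1 a b).mul_right (he a _ (hc b))).mul_left
    ((he b _ (hc a)).symm.mul_right (h2 _ _ (hc a) (hc b)))

end

section Automorphism

variable {M : Type*} [Group M] {ι : Type*} {P : ι → Type u} [∀ i, Group (P i)]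
  (D : DirectSumDecomposition M P) (hD : ∀ i, ∃ a b, ¬ Commute (D.π i a) (D.π i b))

include hD in
theorem eq_of_ker_le {i j : ι} (h : ∀ m, D.π j m = 1 → D.π i m = 1) : i = j := by
  by_contra hij
  obtain ⟨a, b, hab⟩ := hD i
  refine hab ?_
  rw [← D.π_e_same, h _ (D.π_e_of_ne _ _ (Ne.symm hij) a)]
  exact Commute.one_left _

include hD in
/-- Automorphisms permute the kernels of the coordinates. -/
theorem exists_forall_apply_eq_one_iff [∀ i, IsFreeGroup (P i)] (α : M ≃* M) (i : ι) :
    ∃ j, ∀ m, D.π i (α m) = 1 ↔ D.π j m = 1 := by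
  have key : ∀ (α : M ≃* M) i, ∃ j, ∀ m, D.π j m = 1 → D.π i (α m) = 1 := fun α i => by
    obtain ⟨a, b, hab⟩ := hD i
    exact D.exists_forall_eq_one ((D.π i).comp α.toMonoidHom)
      ⟨α.symm a, α.symm b, by simpa using hab⟩
  obtain ⟨j, hj⟩ := key α i
  obtain ⟨k, hk⟩ := key α.symm j
  obtain rfl : i = k := D.eq_of_ker_le hD fun m hm => by
    simpa using hj _ (hk m hm)
  exact ⟨j, fun m => ⟨fun h => by simpa using hk _ h, hj m⟩⟩

end Automorphism

/-! ### Torsion in extensions of direct sums of free groups -/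

section Extension

variable {W : Type u} [Group W] {M : Subgroup W} [M.Normal] {ι : Type*} {P : ι → Type u}
  [∀ i, Group (P i)] (D : DirectSumDecomposition M P)

/-- If conjugation by `v` permutes the kernels of the coordinates according to `s`, then conjugation by
a power of `v` permutes them according to the iterate of `s`. -/
theorem apply_conj_pow_eq_one_iff {v : W} {s : ι → ι}
    (hs : ∀ i m, D.π i (MulAut.conjNormal v m) = 1 ↔ D.π (s i) m = 1) (n : ℕ) :
    ∀ i m, D.π i (MulAut.conjNormal (v ^ n) m) = 1 ↔ D.π (s^[n] i) m = 1 := by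
  induction n with
  | zero =>
    intro i m
    rw [pow_zero, map_one]
    rfl
  | succ n ih =>
    intro i m
    rw [pow_succ', map_mul, MulAut.mul_apply, hs, ih, Function.iterate_succ_apply]

/-- Multiplying `v` by an element `q` of the `r`-th summand multiplies `v ^ (n + 1)` by conjugates of
`q`; the conjugates other than `q` itself have trivial `i`-th coordinate unless an iterate of `s`
moves `i` to `r`. -/
theorem exists_mul_pow_succ_eq {v : W} {s : ι → ι}
    (hs : ∀ i m, D.π i (MulAut.conjNormal v m) = 1 ↔ D.π (s i) m = 1) {r : ι} {q : M}
    (hq : ∀ j, j ≠ r → D.π j q = 1) (n : ℕ) : ∃ x : M, (q * v) ^ (n + 1) = x * v ^ (n + 1) ∧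
      ∀ i, (∀ j, 0 < j → j ≤ n → s^[j] i ≠ r) → D.π i x = D.π i q := by
  induction n with
  | zero => exact ⟨q, by simp, fun i _ => rfl⟩
  | succ n ih =>
    obtain ⟨x, hx, hi⟩ := ih
    refine ⟨x * MulAut.conjNormal (v ^ (n + 1)) q, ?_, fun i h => ?_⟩
    · rw [pow_succ, hx, Subgroup.coe_mul, MulAut.conjNormal_apply]
      group
    · rw [map_mul, hi i fun j hj hjn => h j hj (hjn.trans n.le_succ),
        (D.apply_conj_pow_eq_one_iff hs (n + 1) i q).2 (hq _ (h _ n.succ_pos le_rfl)), mul_one]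

/-- If conjugation by `v` preserves the kernel of the `r`-th coordinate, then the `r`-th coordinate
of the `p`-th power can be made trivial by passing to the quotient by that kernel, in which `M` has
free image. -/
theorem exists_pow_mem_of_fixed [∀ i, IsFreeGroup (P i)] {v : W} {p : ℕ} (hp : p.Prime)
    (hv : v ∉ M) (hcomm : v ^ p ∈ ⁅M, M⁆) {r : ι}
    (hr : ∀ m, D.π r (MulAut.conjNormal v m) = 1 ↔ D.π r m = 1) :
    ∃ q : M, (∀ j, j ≠ r → D.π j q = 1) ∧ ∃ c : M, (c : W) = (q * v) ^ p ∧ D.π r c = 1 := by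
  let L : Subgroup W := (D.π r).ker.map M.subtype
  have hL : ∀ m : M, (m : W) ∈ L ↔ D.π r m = 1 := fun m => by
    simp [L, MonoidHom.mem_ker]
  have hLM : L ≤ M := Subgroup.map_subtype_le _
  let V := Subgroup.normalizer (L : Set W)
  have hnorm : ∀ w : W, (∀ m, D.π r (MulAut.conjNormal w m) = 1 ↔ D.π r m = 1) → w ∈ V := by
    intro w hw
    refine Subgroup.mem_normalizer_iff.2 fun h => ?_
    by_cases hM : h ∈ M
    · rw [hL ⟨h, hM⟩, ← hw, ← hL, MulAut.conjNormal_apply]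
    · refine iff_of_false (fun h1 => hM (hLM h1)) fun h1 => hM ?_
      simpa [mul_assoc] using Subgroup.Normal.conj_mem inferInstance _ (hLM h1) w⁻¹
  have hvV : v ∈ V := hnorm v hr
  have hMV : M ≤ V := fun m hm => hnorm m fun x => by
    have : MulAut.conjNormal m x = ⟨m, hm⟩ * x * ⟨m, hm⟩⁻¹ :=
      Subtype.ext (MulAut.conjNormal_apply _ _)
    rw [this, map_mul, map_mul, map_inv, conj_eq_one_iff]
  have hLn : (L.subgroupOf V).Normal := Subgroup.normal_in_normalizer
  let θ : M →* V ⧸ L.subgroupOf V := (QuotientGroup.mk' _).comp (Subgroup.inclusion hMV)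
  have hθ : ∀ m, θ m = 1 ↔ D.π r m = 1 := fun m => by
    rw [← hL]
    exact (QuotientGroup.eq_one_iff _).trans Subgroup.mem_subgroupOf
  have hker : θ.ker = (D.π r).ker := by
    ext m
    rw [MonoidHom.mem_ker, MonoidHom.mem_ker, hθ]
  have hfree : IsFreeGroup θ.range := IsFreeGroup.ofMulEquiv
    ((QuotientGroup.quotientKerEquivRange (D.π r)).symm.trans
      ((QuotientGroup.quotientMulEquivOfEq hker.symm).trans
        (QuotientGroup.quotientKerEquivRange θ)))
  have hnormal : θ.range.Normal := by
    have : θ.range = (M.subgroupOf V).map (QuotientGroup.mk' (L.subgroupOf V)) := by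
      rw [MonoidHom.range_comp, Subgroup.inclusion_range]
    rw [this]
    exact Subgroup.Normal.map inferInstance _ (QuotientGroup.mk'_surjective _)
  let w : V ⧸ L.subgroupOf V := QuotientGroup.mk' _ ⟨v, hvV⟩
  have hw : w ∉ θ.range := by
    rintro ⟨m, hm⟩
    have h1 := Subgroup.mem_subgroupOf.1 (QuotientGroup.eq.1 hm)
    exact hv (by simpa using mul_mem m.2 (hLM h1))
  have hwp : w ^ p ∈ ⁅θ.range, θ.range⁆ := by
    rw [← Subgroup.map_subtype_commutator] at hcomm
    obtain ⟨c, hc, hcv⟩ := hcomm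
    rw [← map_commutator_eq]
    refine ⟨c, hc, ?_⟩
    rw [← map_pow]
    exact congrArg (QuotientGroup.mk' _) (Subtype.ext hcv)
  obtain ⟨_, ⟨m, rfl⟩, hm⟩ := exists_mul_pow_eq_one_of_pow_mem_commutator hp hw hwp
  refine ⟨D.e r m, fun j hj => D.π_e_of_ne _ _ hj m, ?_⟩
  have hθe : θ (D.e r m) = θ m := by
    rw [← inv_mul_eq_one, ← map_inv, ← map_mul, hθ, map_mul, map_inv, D.π_e_same, inv_mul_cancel]
  rw [← hθe] at hm
  have h1 : (D.e r m * v) ^ p ∈ L := Subgroup.mem_subgroupOf.1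
    ((QuotientGroup.eq_one_iff ((Subgroup.inclusion hMV (D.e r m) * (⟨v, hvV⟩ : V)) ^ p)).1 hm)
  exact ⟨⟨_, hLM h1⟩, rfl, (hL _).1 h1⟩

/-- An element `q` of the `r`-th summand such that `(q v) ^ p` has trivial `r`-th coordinate. If the
`r`-th coordinate is moved by conjugation with `v`, then it occurs only once in the norm, so that
`q` can be chosen to cancel the coordinate of `v ^ p`. -/
theorem exists_pow_apply_eq_one [∀ i, IsFreeGroup (P i)]
    (hD : ∀ i, ∃ a b, ¬ Commute (D.π i a) (D.π i b)) {v : W} {p : ℕ} (hp : p.Prime)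
    (hv : v ∉ M) (hcomm : v ^ p ∈ ⁅M, M⁆) {s : ι → ι}
    (hs : ∀ i m, D.π i (MulAut.conjNormal v m) = 1 ↔ D.π (s i) m = 1) (r : ι) :
    ∃ q : M, (∀ j, j ≠ r → D.π j q = 1) ∧ ∃ c : M, (c : W) = (q * v) ^ p ∧ D.π r c = 1 := by
  by_cases hr : s r = r
  · exact D.exists_pow_mem_of_fixed hp hv hcomm fun m => by rw [hs, hr]
  let c : M := ⟨v ^ p, Subgroup.commutator_le_left M M hcomm⟩
  have hper : s^[p] r = r := D.eq_of_ker_le hD fun m hm => by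
    rw [← D.apply_conj_pow_eq_one_iff hs]
    have : MulAut.conjNormal (v ^ p) m = c * m * c⁻¹ := Subtype.ext (MulAut.conjNormal_apply _ _)
    rw [this, map_mul, map_mul, map_inv, hm, mul_one, mul_inv_cancel]
  have hne : ∀ j, 0 < j → j < p → s^[j] r ≠ r := by
    intro j hj hjp h
    have h1 : Function.IsPeriodicPt s (p.gcd j) r := Function.IsPeriodicPt.gcd hper h
    rw [Nat.Coprime.gcd_eq_one (Nat.coprime_of_lt_prime hj.ne' hjp hp)] at h1
    exact hr h1
  obtain ⟨n, rfl⟩ := Nat.exists_eq_succ_of_ne_zero hp.ne_zero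
  have hq : ∀ j, j ≠ r → D.π j (D.e r c⁻¹) = 1 := fun j hj => D.π_e_of_ne _ _ hj _
  obtain ⟨x, hx, hxr⟩ := D.exists_mul_pow_succ_eq hs hq n
  refine ⟨_, hq, x * c, hx.symm, ?_⟩
  rw [map_mul, hxr r fun j hj hjn => hne j hj (Nat.lt_succ_of_le hjn), D.π_e_same, map_inv,
    inv_mul_cancel]

/-- The coordinates of the `p`-th power can be made trivial one by one: making the `r`-th one trivial
changes only the coordinates in the orbit of `r`, and these become trivial as well since
`(q v) ^ p` commutes with `q v`. -/
theorem exists_pow_reduction [∀ i, IsFreeGroup (P i)]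
    (hD : ∀ i, ∃ a b, ¬ Commute (D.π i a) (D.π i b)) {v : W} {p : ℕ} (hp : p.Prime)
    (hv : v ∉ M) {c : M} (hc : (c : W) = v ^ p) (hcomm : c ∈ commutator M) (r : ι) :
    ∃ q c' : M, (c' : W) = (q * v) ^ p ∧ D.π r c' = 1 ∧
      ∀ i, D.π i c' = 1 ∨ D.π i c' = D.π i c := by
  choose s hs using D.exists_forall_apply_eq_one_iff hD (MulAut.conjNormal v)
  have hcomm' : v ^ p ∈ ⁅M, M⁆ := by
    rw [← Subgroup.map_subtype_commutator]
    exact ⟨c, hcomm, hc⟩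
  obtain ⟨q, hq, c', hc', hr⟩ := D.exists_pow_apply_eq_one hD hp hv hcomm' hs r
  refine ⟨q, c', hc', hr, fun i => ?_⟩
  by_cases hi : ∃ n, s^[n] i = r
  · left
    obtain ⟨n, hn⟩ := hi
    have hs' : ∀ i m, D.π i (MulAut.conjNormal (q * v) m) = 1 ↔ D.π (s i) m = 1 := fun i m => by
      have : MulAut.conjNormal (q * v) m = q * MulAut.conjNormal v m * q⁻¹ := Subtype.ext (by
        simp only [MulAut.conjNormal_apply, Subgroup.coe_mul, Subgroup.coe_inv]
        group)
      rw [this, map_mul, map_mul, map_inv, conj_eq_one_iff, hs]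
    have hfix : MulAut.conjNormal ((q * v) ^ n) c' = c' := Subtype.ext (by
      rw [MulAut.conjNormal_apply, hc']
      group)
    rw [← hfix, D.apply_conj_pow_eq_one_iff hs', hn, hr]
  · right
    obtain ⟨n, rfl⟩ := Nat.exists_eq_succ_of_ne_zero hp.ne_zero
    obtain ⟨x, hx, hxi⟩ := D.exists_mul_pow_succ_eq hs hq n
    have h1 : c' = x * c := Subtype.ext (by rw [hc', Subgroup.coe_mul, hc, hx])
    rw [h1, map_mul, hxi i fun j _ _ h => hi ⟨j, h⟩, hq i fun h => hi ⟨0, h⟩, one_mul]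

/-- Otherwise removing the coordinates of the power one by one yields a torsion element outside
`M`. -/
theorem pow_notMem_commutator [∀ i, IsFreeGroup (P i)]
    (hD : ∀ i, ∃ a b, ¬ Commute (D.π i a) (D.π i b)) (hW : GroupIsTorsionFree W) {p : ℕ}
    (hp : p.Prime) : ∀ v ∉ M, v ^ p ∉ ⁅M, M⁆ := by
  classical
  suffices ∀ (s : Finset ι) (v : W), v ∉ M → ∀ c ∈ commutator M, (c : W) = v ^ p →
      ∃ i ∉ s, D.π i c ≠ 1 by
    intro v hv hcomm
    rw [← Subgroup.map_subtype_commutator] at hcomm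
    obtain ⟨c, hc, hcv⟩ := hcomm
    obtain ⟨i, hi, hne⟩ := this (D.finite c).toFinset v hv c hc hcv
    exact hi (by simpa using hne)
  intro s
  induction s using Finset.induction_on with
  | empty =>
    intro v hv c _ hcv
    by_contra! h
    have h1 := D.eq_one c fun i => h i (Finset.notMem_empty i)
    rw [h1, Subgroup.coe_one] at hcv
    rw [hW.eq_one_of_pow_eq_one hp.ne_zero hcv.symm] at hv
    exact hv (one_mem M)
  | insert r s _ ih =>
    intro v hv c hc hcv
    obtain ⟨q, c', hc', hr, hi⟩ := D.exists_pow_reduction hD hp hv hcv hc r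
    obtain ⟨i, his, hne⟩ := ih (q * v) (fun h => hv ((Subgroup.mul_mem_cancel_left M q.2).1 h)) c'
      (D.mem_commutator fun i => (hi i).elim (fun h => ⟨1, one_mem _, by rw [h, map_one]⟩)
        fun h => ⟨c, hc, h⟩) hc'
    refine ⟨i, fun h => ?_, (hi i).resolve_left hne ▸ hne⟩
    rcases Finset.mem_insert.1 h with rfl | h
    · exact hne hr
    · exact his h

theorem isTorsionFree_quotient_commutator [∀ i, IsFreeGroup (P i)]
    (hD : ∀ i, ∃ a b, ¬ Commute (D.π i a) (D.π i b)) (hW : GroupIsTorsionFree W) :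
    GroupIsTorsionFree (W ⧸ ⁅M, M⁆) := by
  refine .quotient_of_prime fun v hv p hp hvp => ?_
  by_cases hvM : v ∈ M
  · rw [← Subgroup.map_subtype_commutator] at hv hvp
    obtain ⟨c, hc, hcv⟩ := hvp
    have hc' : (⟨v, hvM⟩ : M) ^ p = c := Subtype.ext hcv.symm
    refine hv ⟨⟨v, hvM⟩, D.mem_commutator fun i => ?_, rfl⟩
    have hmap : (commutator M).map (D.π i).rangeRestrict = commutator (D.π i).range := by
      rw [map_commutator_eq, MonoidHom.range_eq_top.2 (D.π i).rangeRestrict_surjective,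
        commutator_def]
    have h1 : (D.π i).rangeRestrict ⟨v, hvM⟩ ∈ commutator (D.π i).range := by
      refine mem_commutator_of_pow_mem hp.ne_zero ?_
      rw [← map_pow, hc', ← hmap]
      exact ⟨c, hc, rfl⟩
    rw [← hmap] at h1
    obtain ⟨d, hd, hdv⟩ := h1
    exact ⟨d, hd, (congrArg Subtype.val hdv).symm⟩
  · exact D.pow_notMem_commutator hD hW hp v hvM hvp

end Extension

end DirectSumDecomposition

/-! ### Extensions of direct sums of free groups -/

section DirectSum

variable {ι : Type u} {F : ι → Type u} [∀ i, Group (F i)]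

open Classical in
/-- The inclusion of a summand into a direct sum. -/
noncomputable def directSumSingle (F : ι → Type u) [∀ i, Group (F i)] (i : ι) :
    F i →* groupDirectSum F :=
  (MonoidHom.mulSingle F i).codRestrict _ fun x =>
    (Set.finite_singleton i).subset fun j hj => by
      by_contra h
      exact hj (Pi.mulSingle_eq_of_ne h x)

theorem directSumSingle_apply_same (i : ι) (x : F i) : (directSumSingle F i x).1 i = x := by
  classical
  exact Pi.mulSingle_eq_same i x

theorem directSumSingle_apply_of_ne {i j : ι} (h : j ≠ i) (x : F i) :
    (directSumSingle F i x).1 j = 1 := by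
  classical
  exact Pi.mulSingle_eq_of_ne h x

/-- The projection from a direct sum to a summand. -/
def directSumEval (F : ι → Type u) [∀ i, Group (F i)] (i : ι) : groupDirectSum F →* F i :=
  (Pi.evalMonoidHom F i).comp (groupDirectSum F).subtype

variable {G : Type u} [Group G] {N : Subgroup G} (e : groupDirectSum F ≃* N)

theorem apply_mem_commutator {H : Type*} [Group H] (f : H →* N) {x : H} (hx : x ∈ commutator H) :
    (f x : G) ∈ ⁅N, N⁆ := by
  have h1 : f x ∈ (commutator H).map f := ⟨x, hx, rfl⟩
  rw [map_commutator_eq] at h1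
  rw [← Subgroup.map_subtype_commutator]
  exact ⟨f x, Subgroup.commutator_mono le_top le_top h1, rfl⟩

variable [N.Normal]

/-- The commutator subgroup of a direct sum decomposes as the direct sum of the commutator subgroups
of the noncommutative summands. -/
noncomputable def commutatorDecomposition :
    DirectSumDecomposition (⁅N, N⁆ : Subgroup G)
      fun i : {i // ∃ a b : F i, ¬ Commute a b} => F i where
  π i := ((directSumEval F i).comp e.symm.toMonoidHom).comp
    (Subgroup.inclusion (Subgroup.commutator_le_left N N))
  e i := ((N.subtype.comp (e.toMonoidHom.comp ((directSumSingle F i).comp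
    ((directSumEval F i).comp e.symm.toMonoidHom)))).comp
      (Subgroup.inclusion (Subgroup.commutator_le_left N N))).codRestrict _ (by
    rintro ⟨x, hx⟩
    rw [← Subgroup.map_subtype_commutator] at hx
    obtain ⟨y, hy, rfl⟩ := hx
    exact apply_mem_commutator (e.toMonoidHom.comp ((directSumSingle F i).comp
      ((directSumEval F i).comp e.symm.toMonoidHom))) hy)
  π_e_same i m := by
    change (e.symm (e (directSumSingle F i _))).1 i = _
    rw [e.symm_apply_apply, directSumSingle_apply_same]
    rfl
  π_e_of_ne i j hij m := by
    change (e.symm (e (directSumSingle F i _))).1 j = _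
    rw [e.symm_apply_apply, directSumSingle_apply_of_ne fun h => hij (Subtype.ext h)]
  eq_one m h := by
    refine (MonoidHom.ker_eq_bot_iff (e.symm.toMonoidHom.comp
      (Subgroup.inclusion (Subgroup.commutator_le_left N N)))).2
      (e.symm.injective.comp (Subgroup.inclusion_injective _)) |>.le (Subtype.ext ?_)
    funext i
    by_cases hi : ∃ a b : F i, ¬ Commute a b
    · exact h ⟨i, hi⟩
    · push Not at hi
      -- the commutative summands do not contribute to commutators
      obtain ⟨x, hx⟩ := m
      rw [← Subgroup.map_subtype_commutator] at hx
      obtain ⟨y, hy, rfl⟩ := hx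
      have h1 : commutator N ≤ ((directSumEval F i).comp e.symm.toMonoidHom).ker := by
        rw [commutator_def, Subgroup.commutator_le]
        intro a _ b _
        rw [MonoidHom.mem_ker, map_commutatorElement, commutatorElement_eq_one_iff_mul_comm]
        exact hi _ _
      exact h1 hy
  finite m := ((e.symm (Subgroup.inclusion (Subgroup.commutator_le_left N N) m)).2.preimage
    Subtype.val_injective.injOn).subset fun i hi => hi

theorem commutatorDecomposition_not_commute (hF : ∀ i, IsFreeGroup (F i))
    (i : {i // ∃ a b : F i, ¬ Commute a b}) :
    ∃ a b, ¬ Commute ((commutatorDecomposition e).π i a) ((commutatorDecomposition e).π i b) := by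
  obtain ⟨x, y, hxy⟩ := i.2
  have := hF i
  obtain ⟨a, ha, b, hb, hab⟩ := IsFreeGroup.exists_commutator_not_commute hxy
  let f : F i →* N := e.toMonoidHom.comp (directSumSingle F i)
  have hf : ∀ c (hc : c ∈ commutator (F i)),
      (commutatorDecomposition e).π i ⟨f c, apply_mem_commutator f hc⟩ = c := fun c hc => by
    change (e.symm (e (directSumSingle F i c))).1 i = c
    rw [e.symm_apply_apply, directSumSingle_apply_same]
  refine ⟨⟨f a, apply_mem_commutator f ha⟩, ⟨f b, apply_mem_commutator f hb⟩, ?_⟩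
  rwa [hf a ha, hf b hb]

end DirectSum

/-- For `M = ⁅N, N⁆` the quotient by `⁅M, M⁆` is torsion-free and elementary amenable, with kernel inside
a direct sum of free groups. -/
theorem LinnellCPrime.schickD {G : Type u} [Group G] (hG : LinnellCPrime G)
    (ht : GroupIsTorsionFree G) : SchickD G := by
  obtain ⟨ι, F, _, A, _, hF, hA, ⟨S⟩⟩ := hG
  let N : Subgroup G := S.rightHom.ker
  let e : groupDirectSum F ≃* N :=
    (MonoidHom.ofInjective S.inl_injective).trans
      (MulEquiv.subgroupCongr S.range_inl_eq_ker_rightHom)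
  have hN : IsElementaryAmenable (G ⧸ N) := by
    let q := QuotientGroup.quotientKerEquivOfSurjective S.rightHom S.rightHom_surjective
    refine .of_ker q.toMonoidHom q.surjective (.ofFinite ?_) hA
    rw [(MonoidHom.ker_eq_bot_iff q.toMonoidHom).2 q.injective]
    infer_instance
  let M : Subgroup G := ⁅N, N⁆
  have htor : GroupIsTorsionFree (G ⧸ ⁅M, M⁆) :=
    (commutatorDecomposition e).isTorsionFree_quotient_commutator
      (commutatorDecomposition_not_commute e hF) ht
  refine .of_ker hN.quotient_commutator.quotient_commutator htor (QuotientGroup.mk' _)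
    (QuotientGroup.mk'_surjective _) ?_
  rw [QuotientGroup.ker_mk']
  have hle : ⁅M, M⁆ ≤ N :=
    (Subgroup.commutator_le_left M M).trans (Subgroup.commutator_le_left N N)
  exact .subgroup (e.symm.toMonoidHom.comp (Subgroup.inclusion hle))
    (e.symm.injective.comp (Subgroup.inclusion_injective hle))
    (.directSum F fun i => .of_isFreeGroup (F i))

theorem mainTheorem3 :
    (∀ (G : Type u) [Group G], GroupIsTorsionFree G → LinnellC G → SchickD G) ∧
    (∀ (G : Type u) [Group G], GroupIsTorsionFree G → LinnellCPrime G → SchickD G) ∧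
    (∀ (ι : Type u) (G : ι → Type u) [∀ i, Group (G i)], (∀ i, SchickD (G i)) →
      SchickD (groupDirectSum G)) ∧
    (∀ (ι : Type u) (G : ι → Type u) [∀ i, Group (G i)], (∀ i, SchickD (G i)) →
      SchickD (∀ i, G i)) ∧
    (∀ (ι : Type u) (G : ι → Type u) [∀ i, Group (G i)], (∀ i, SchickD (G i)) →
      SchickD (Monoid.CoprodI G)) := by
  exact ⟨fun G _ ht hG => hG.schickD ht, fun G _ ht hG => hG.schickD ht,
    fun ι G _ h => .directSum G h, fun ι G _ h => .pi G h, fun ι G _ h => .coprodI G h⟩
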